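/- Let $k$ be a field of characteristic zero and let $A$ be a ($\mathbb{Z}$-graded, unital, associative) dg $k$-algebra which is proper ($\sum_n \dim_k H^n(A)<\infty$) and homologically smooth ($A\in D_{\mathrm{per}}(A^e)$, where $A^e=A\otimes_k A^{\mathrm{op}}$; that is, there is a quasi-isomorphism $P\to A$ of left dg $A^e$-modules with $P$ perfect, a perfect module being a homotopy direct summand of a finitely generated semi-free module). Regard $A$ as a left $A^e$-module by $(a\otimes b)\,x=(-1)^{|b||x|}axb$ and $A^{\mathrm{op}}$ as a right $A^e$-module by $x\,(a\otimes b)=(-1)^{|b|(|a|+|x|)}bxa$. Put $\omega_A^{-1}=\mathrm{RHom}_{A^e}(A^{\mathrm{op}},A^e)$ (homomorphisms of right $A^e$-modules), with its left $A^e$-module structure $(c\varphi)(x)=c\,\varphi(x)$. Then the canonical evaluation morphism $$A^{\mathrm{op}}\otimes^{L}_{A^e}A\;\longrightarrow\;\mathrm{RHom}_{A^e}(\omega_A^{-1},A),\qquad x\otimes a\longmapsto\bigl(\varphi\mapsto(-1)^{|\varphi|(|x|+|a|)}\varphi(x)\,a\bigr),$$ from the Hochschild homology of $A$ is an isomorphism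 in the derived category $D(k)$, and it is natural in the following sense. Precisely: the right $A^e$-module $A^{\mathrm{op}}$ has a homotopically projective resolution, and for every homotopically projective resolution $P\to A^{\mathrm{op}}$ the left $A^e$-module $\mathrm{Hom}_{A^e}(P,A^e)$ has a homotopically projective resolution. For all homotopically projective resolutions $P\to A^{\mathrm{op}}$ and $Q\xrightarrow{\ \pi\ }\mathrm{Hom}_{A^e}(P,A^e)$, the morphism of complexes of $k$-modules $P\otimes_{A^e}A\to\mathrm{Hom}_{A^e}(Q,A)$, $p\otimes a\mapsto\bigl(q\mapsto(-1)^{|q|(|p|+|a|)}\pi(q)(p)\,a\bigr)$, becomes an isomorphism in $D(k)$. It does not depend on the resolutions: for any other such pair $P'\to A^{\mathrm{op}}$, $Q'\to\mathrm{Hom}_{A^e}(P',A^e)$ there are closed degree-zero morphisms $f:P\to P'$ and, for each such $f$, $g:Q'\to Q$, compatible up to homotopy with the maps to $A^{\mathrm{op}}$ and to $\mathrm{Hom}_{A^e}(P,A^e)$ respectively; and for all such $f$ and $g$ the square formed by the two evaluation morphisms and the morphisms $P\otimes_{A^e}A\to P'\otimes_{A^e}A$, $\mathrm{Hom}_{A^e}(Q,A)\to\mathrm{Hom}_{A^e}(Q',A)$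 induced by $f$ and $g$ commutes in $D(k)$. -/

import Mathlib

open CategoryTheory
open scoped TensorProduct

universe w v u

noncomputable section

namespace DG

/-! ### Signs and graded vector spaces -/

/-- The sign `(-1)^n` as a scalar. -/
def sg (k : Type v) [Field k] (n : ℤ) : k := ((n.negOnePow : ℤ) : k)

section Sign
variable {k : Type v} [Field k]

theorem sg_add (m n : ℤ) : sg k (m + n) = sg k m * sg k n := by
  simp [sg, Int.negOnePow_add]

@[simp] theorem sg_zero : sg k 0 = 1 := by simp [sg]

theorem sg_one : sg k 1 = -1 := by simp [sg]

theorem sg_succ (n : ℤ) : sg k (n + 1) = - sg k n := by simp [sg_add, sg_one]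

theorem sg_mul_self (n : ℤ) : sg k n * sg k n = 1 := by
  rw [← sg_add]
  simp [sg, Int.negOnePow_even (n + n) ⟨n, rfl⟩]

theorem sg_congr {m n : ℤ} (c : ℤ) (h : m = n + 2 * c) : sg k m = sg k n := by
  subst h
  simp [sg, Int.negOnePow_add]

theorem units_smul_eq {M : Type*} [AddCommGroup M] [Module k M] (n : ℤ) (x : M) :
    ((-1 : ℤˣ) ^ n) • x = sg k n • x := by
  rw [sg, Int.cast_smul_eq_zsmul, ← Units.smul_def]
  rfl

end Sign

section Graded
variable {k : Type v} [Field k] {M N P : Type*}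
  [AddCommGroup M] [Module k M] [AddCommGroup N] [Module k N] [AddCommGroup P] [Module k P]
  (ℳ : ℤ → Submodule k M) [DirectSum.Decomposition ℳ]
  (𝒩 : ℤ → Submodule k N) [DirectSum.Decomposition 𝒩]

/-- The linear map which is given by `F p` on the elements of degree `p`. -/
def byDeg (F : ℤ → M →ₗ[k] P) : M →ₗ[k] P :=
  (DirectSum.toModule k ℤ P fun p => F p ∘ₗ (ℳ p).subtype) ∘ₗ
    (DirectSum.decomposeLinearEquiv ℳ).toLinearMap

theorem byDeg_apply (F : ℤ → M →ₗ[k] P) {p : ℤ} {m : M} (hm : m ∈ ℳ p) :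
    byDeg ℳ F m = F p m := by
  simp only [byDeg, LinearMap.comp_apply, LinearEquiv.coe_coe,
    DirectSum.decomposeLinearEquiv_apply, DirectSum.decompose_of_mem ℳ hm,
    ← DirectSum.lof_eq_of k]
  rw [DirectSum.toModule_lof]
  rfl

theorem ext_homogeneous {f g : M →ₗ[k] P} (h : ∀ p, ∀ m ∈ ℳ p, f m = g m) : f = g :=
  DirectSum.decompose_lhom_ext ℳ fun p => by
    ext m
    exact h p m m.2

@[elab_as_elim]
theorem hom_induction {C : M → Prop} (x : M) (hz : C 0) (ha : ∀ x y, C x → C y → C (x + y))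
    (hh : ∀ p, ∀ m ∈ ℳ p, C m) : C x :=
  DirectSum.Decomposition.inductionOn ℳ hz (fun {p} m => hh p m m.2) ha x

/-- The projection to the component of degree `n`. -/
def proj (n : ℤ) : M →ₗ[k] M := byDeg ℳ fun p => if p = n then LinearMap.id else 0

theorem proj_same {n : ℤ} {m : M} (hm : m ∈ ℳ n) : proj ℳ n m = m := by
  simp [proj, byDeg_apply ℳ _ hm]

theorem proj_ne {n p : ℤ} (h : p ≠ n) {m : M} (hm : m ∈ ℳ p) : proj ℳ n m = 0 := by
  simp [proj, byDeg_apply ℳ _ hm, h]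

/-- `m ↦ (-1)^{n|m|} m`. -/
def sgnMap (n : ℤ) : M →ₗ[k] M := byDeg ℳ fun p => sg k (n * p) • LinearMap.id

theorem sgnMap_apply (n : ℤ) {p : ℤ} {m : M} (hm : m ∈ ℳ p) :
    sgnMap ℳ n m = sg k (n * p) • m := by
  simp [sgnMap, byDeg_apply ℳ _ hm]

/-- The bilinear map `(m, n) ↦ (-1)^{|m||n|} f(m, n)`. -/
def koszul (f : M →ₗ[k] N →ₗ[k] P) : M →ₗ[k] N →ₗ[k] P :=
  byDeg ℳ fun p => f.compl₂ (sgnMap 𝒩 p)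

theorem koszul_apply (f : M →ₗ[k] N →ₗ[k] P) {p q : ℤ} {m : M} {n : N} (hm : m ∈ ℳ p)
    (hn : n ∈ 𝒩 q) : koszul ℳ 𝒩 f m n = sg k (p * q) • f m n := by
  simp [koszul, byDeg_apply ℳ _ hm, sgnMap_apply 𝒩 _ hn]

end Graded

theorem isInternal_of_proj {k : Type v} [Field k] {M P : Type*} [AddCommGroup M] [Module k M]
    [AddCommGroup P] [Module k P] (ℳ : ℤ → Submodule k M) (j : M →ₗ[k] P) (hj : Function.Injective j) (π : ℤ → M →ₗ[k] P)
    (h1 : ∀ n, ∀ m ∈ ℳ n, π n m = j m) (h0 : ∀ n p, p ≠ n → ∀ m ∈ ℳ p, π n m = 0)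
    (hs : ⨆ n, ℳ n = ⊤) : DirectSum.IsInternal ℳ := by
  refine DirectSum.isInternal_submodule_of_iSupIndep_of_iSup_eq_top ?_ hs
  intro n
  rw [Submodule.disjoint_def]
  intro x hx hx'
  apply hj
  rw [← h1 n x hx, map_zero]
  have : (⨆ p, ⨆ (_ : p ≠ n), ℳ p) ≤ LinearMap.ker (π n) :=
    iSup_le fun p => iSup_le fun hp m hm => h0 n p hp m hm
  exact this hx'


/-! ### Differential graded algebras -/

/-- A differential graded `k`-algebra (unital, associative, graded by `ℤ`, differential of
degree `1`). -/
structure DGAlg (k : Type v) [Field k] : Type (max v (u + 1)) where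
  carrier : Type u
  [ring : Ring carrier]
  [algebra : Algebra k carrier]
  gr : ℤ → Submodule k carrier
  internal : DirectSum.IsInternal gr
  one_mem : (1 : carrier) ∈ gr 0
  mul_mem : ∀ {p q : ℤ} {a b : carrier}, a ∈ gr p → b ∈ gr q → a * b ∈ gr (p + q)
  d : carrier →ₗ[k] carrier
  d_mem : ∀ {p : ℤ} {a : carrier}, a ∈ gr p → d a ∈ gr (p + 1)
  d_d : ∀ a : carrier, d (d a) = 0
  d_mul : ∀ {p : ℤ} {a : carrier}, a ∈ gr p → ∀ b : carrier,
    d (a * b) = d a * b + sg k p • (a * d b)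

namespace DGAlg

variable {k : Type v} [Field k]

instance : CoeSort (DGAlg.{v, u} k) (Type u) := ⟨DGAlg.carrier⟩

instance (A : DGAlg.{v, u} k) : Ring A := A.ring

instance (A : DGAlg.{v, u} k) : Algebra k A := A.algebra

instance (A : DGAlg.{v, u} k) : GradedAlgebra A.gr where
  toDecomposition := A.internal.chooseDecomposition
  one_mem := A.one_mem
  mul_mem _ _ _ _ := A.mul_mem

variable (A : DGAlg.{v, u} k)

theorem mem_deg {p q : ℤ} {a : A} (ha : a ∈ A.gr p) (h : p = q) : a ∈ A.gr q := h ▸ ha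

theorem d_one : A.d 1 = 0 := by
  have h := A.d_mul A.one_mem 1
  simpa using h

/-- The multiplication `(a, b) ↦ (-1)^{|a||b|} b a` of the opposite algebra. -/
def opMul : A →ₗ[k] A →ₗ[k] A := koszul A.gr A.gr (LinearMap.mul k A).flip

theorem opMul_apply {p q : ℤ} {a b : A} (ha : a ∈ A.gr p) (hb : b ∈ A.gr q) :
    A.opMul a b = sg k (p * q) • (b * a) := by
  simp [opMul, koszul_apply A.gr A.gr _ ha hb]

theorem opMul_mem {p q : ℤ} {a b : A} (ha : a ∈ A.gr p) (hb : b ∈ A.gr q) :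
    A.opMul a b ∈ A.gr (p + q) := by
  rw [A.opMul_apply ha hb]
  exact Submodule.smul_mem _ _ (A.mem_deg (A.mul_mem hb ha) (add_comm _ _))

theorem opMul_assoc (a b c : A) : A.opMul (A.opMul a b) c = A.opMul a (A.opMul b c) := by
  refine hom_induction A.gr a (by simp) (fun x y hx hy => by simp [hx, hy]) fun p a ha => ?_
  refine hom_induction A.gr b (by simp) (fun x y hx hy => by simp [hx, hy]) fun q b hb => ?_
  refine hom_induction A.gr c (by simp) (fun x y hx hy => by simp [hx, hy]) fun r c hc => ?_
  rw [A.opMul_apply (A.opMul_mem ha hb) hc, A.opMul_apply ha (A.opMul_mem hb hc),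
    A.opMul_apply ha hb, A.opMul_apply hb hc]
  simp only [mul_smul_comm, smul_mul_assoc, smul_smul, mul_assoc, ← sg_add]
  rw [sg_congr 0]
  ring

theorem one_opMul (a : A) : A.opMul 1 a = a := by
  refine hom_induction A.gr a (by simp) (fun x y hx hy => by simp [hx, hy]) fun p a ha => ?_
  simp [A.opMul_apply A.one_mem ha]

theorem opMul_one (a : A) : A.opMul a 1 = a := by
  refine hom_induction A.gr a (by simp) (fun x y hx hy => by simp [hx, hy]) fun p a ha => ?_
  simp [A.opMul_apply ha A.one_mem]

theorem d_opMul {p : ℤ} {a : A} (ha : a ∈ A.gr p) (b : A) :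
    A.d (A.opMul a b) = A.opMul (A.d a) b + sg k p • A.opMul a (A.d b) := by
  refine hom_induction A.gr b (by simp) (fun x y hx hy => ?_) fun q b hb => ?_
  · simp only [map_add, hx, hy, smul_add]
    abel
  rw [A.opMul_apply ha hb, A.opMul_apply (A.d_mem ha) hb, A.opMul_apply ha (A.d_mem hb),
    map_smul, A.d_mul hb, smul_add, smul_smul, smul_smul, ← sg_add, ← sg_add, add_comm]
  congr 2
  · exact sg_congr 0 (by ring)
  · exact sg_congr (-p) (by ring)

/-- The underlying space of the opposite algebra. -/
def OpCarrier : Type u := A.carrier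

instance : AddCommGroup A.OpCarrier := inferInstanceAs (AddCommGroup A.carrier)

instance : Module k A.OpCarrier := inferInstanceAs (Module k A.carrier)

instance : Ring A.OpCarrier where
  __ := (inferInstance : AddCommGroup A.OpCarrier)
  mul := fun a b => A.opMul a b
  one := (1 : A.carrier)
  mul_assoc := A.opMul_assoc
  one_mul := A.one_opMul
  mul_one := A.opMul_one
  left_distrib := fun a b c => map_add (A.opMul a) b c
  right_distrib := fun a b c => LinearMap.map_add₂ A.opMul a b c
  zero_mul := fun a => LinearMap.map_zero₂ A.opMul a
  mul_zero := fun a => map_zero (A.opMul a)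

instance : Algebra k A.OpCarrier :=
  Algebra.ofModule (fun r x y => LinearMap.map_smul₂ A.opMul r x y)
    (fun r x y => map_smul (A.opMul x) r y)

/-- The opposite dg algebra: the same dg `k`-module with the multiplication
`a · b = (-1)^{|a||b|} b a`. -/
def op : DGAlg.{v, u} k where
  carrier := A.OpCarrier
  gr := A.gr
  internal := A.internal
  one_mem := A.one_mem
  mul_mem := A.opMul_mem
  d := A.d
  d_mem := A.d_mem
  d_d := A.d_d
  d_mul := A.d_opMul

/-- The identity map `A → Aᵒᵖ`. -/
def toOp : A ≃ₗ[k] A.op where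
  toFun a := a
  invFun a := a
  left_inv _ := rfl
  right_inv _ := rfl
  map_add' _ _ := rfl
  map_smul' _ _ := rfl

theorem op_mul (a b : A) : A.toOp a * A.toOp b = A.toOp (A.opMul a b) := rfl

theorem op_d (a : A) : A.op.d (A.toOp a) = A.toOp (A.d a) := rfl

theorem op_one : (1 : A.op) = A.toOp 1 := rfl

theorem mem_op {p : ℤ} {a : A} : A.toOp a ∈ A.op.gr p ↔ a ∈ A.gr p := Iff.rfl


section Tensor

open GradedTensorProduct

variable (B : DGAlg.{v, u} k)

/-- The underlying algebra of `A ⊗ B`, with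
`(a ⊗ b)(a' ⊗ b') = (-1)^{|b||a'|} aa' ⊗ bb'`. -/
abbrev TensorCarrier : Type u := GradedTensorProduct k A.gr B.gr

/-- The degree `n` part of `A ⊗ B`. -/
def tensorGr (n : ℤ) : Submodule k (A.TensorCarrier B) :=
  Submodule.span k {x | ∃ p q : ℤ, p + q = n ∧ ∃ a ∈ A.gr p, ∃ b ∈ B.gr q, x = a ᵍ⊗ₜ[k] b}

/-- The differential of `A ⊗ B`: `d (a ⊗ b) = da ⊗ b + (-1)^{|a|} a ⊗ db`. -/
def tensorD : A.TensorCarrier B →ₗ[k] A.TensorCarrier B :=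
  (of k A.gr B.gr).toLinearMap ∘ₗ
    (TensorProduct.map A.d LinearMap.id + TensorProduct.map (sgnMap A.gr 1) B.d) ∘ₗ
      (of k A.gr B.gr).symm.toLinearMap

variable {A B}

theorem tmul_mul_tmul {q p : ℤ} (a : A) {b : B} (hb : b ∈ B.gr q) {a' : A} (ha' : a' ∈ A.gr p)
    (b' : B) : (a ᵍ⊗ₜ[k] b : A.TensorCarrier B) * (a' ᵍ⊗ₜ[k] b') =
      sg k (q * p) • ((a * a') ᵍ⊗ₜ[k] (b * b')) := by
  rw [← units_smul_eq]
  exact tmul_coe_mul_coe_tmul A.gr B.gr a ⟨b, hb⟩ ⟨a', ha'⟩ b'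

theorem tensorD_tmul {p : ℤ} {a : A} (ha : a ∈ A.gr p) (b : B) :
    A.tensorD B (a ᵍ⊗ₜ[k] b) = A.d a ᵍ⊗ₜ[k] b + sg k p • (a ᵍ⊗ₜ[k] B.d b) := by
  simp [tensorD, sgnMap_apply A.gr 1 ha, ← TensorProduct.smul_tmul']

theorem tmul_mem {p q n : ℤ} (h : p + q = n) {a : A} (ha : a ∈ A.gr p) {b : B}
    (hb : b ∈ B.gr q) : (a ᵍ⊗ₜ[k] b : A.TensorCarrier B) ∈ A.tensorGr B n :=
  Submodule.subset_span ⟨p, q, h, a, ha, b, hb, rfl⟩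

@[elab_as_elim]
theorem tensor_induction {C : A.TensorCarrier B → Prop} (x : A.TensorCarrier B) (hz : C 0)
    (ha : ∀ x y, C x → C y → C (x + y))
    (hh : ∀ p q, ∀ a ∈ A.gr p, ∀ b ∈ B.gr q, C (a ᵍ⊗ₜ[k] b)) : C x := by
  refine TensorProduct.induction_on (motive := fun y => C (of k A.gr B.gr y))
    ((of k A.gr B.gr).symm x) hz (fun a b => ?_) (fun x y hx hy => ?_)
  · refine hom_induction A.gr a ?_ (fun x y hx hy => ?_) fun p a hp => ?_
    · rwa [TensorProduct.zero_tmul, map_zero]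
    · rw [TensorProduct.add_tmul, map_add]
      exact ha _ _ hx hy
    refine hom_induction B.gr b ?_ (fun x y hx hy => ?_) fun q b hq => ?_
    · rwa [TensorProduct.tmul_zero, map_zero]
    · rw [TensorProduct.tmul_add, map_add]
      exact ha _ _ hx hy
    exact hh p q a hp b hq
  · rw [map_add]
    exact ha _ _ hx hy

@[elab_as_elim]
theorem tensorGr_induction {n : ℤ} {C : A.TensorCarrier B → Prop} {x : A.TensorCarrier B}
    (hx : x ∈ A.tensorGr B n) (hz : C 0) (ha : ∀ x y, C x → C y → C (x + y))
    (hs : ∀ (r : k) x, C x → C (r • x))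
    (hh : ∀ p q, p + q = n → ∀ a ∈ A.gr p, ∀ b ∈ B.gr q, C (a ᵍ⊗ₜ[k] b)) : C x := by
  refine Submodule.span_induction ?_ hz (fun x y _ _ => ha x y) (fun r x _ => hs r x) hx
  rintro _ ⟨p, q, h, a, hp, b, hq, rfl⟩
  exact hh p q h a hp b hq

theorem tensor_internal : DirectSum.IsInternal (A.tensorGr B) := by
  let π (n : ℤ) : A.TensorCarrier B →ₗ[k] A.TensorCarrier B :=
    (of k A.gr B.gr).toLinearMap ∘ₗ
      TensorProduct.lift (byDeg A.gr fun p => (TensorProduct.mk k A B).compl₂ (proj B.gr (n - p)))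
      ∘ₗ (of k A.gr B.gr).symm.toLinearMap
  have hπ (n : ℤ) {p : ℤ} {a : A} (ha : a ∈ A.gr p) (b : B) :
      π n (a ᵍ⊗ₜ[k] b) = a ᵍ⊗ₜ[k] (proj B.gr (n - p) b) := by
    simp [π, byDeg_apply A.gr _ ha]
  refine isInternal_of_proj _ LinearMap.id Function.injective_id π ?_ ?_ ?_
  · intro n x hx
    refine tensorGr_induction hx (map_zero _) (fun x y hx hy => by rw [map_add, hx, hy, map_add])
      (fun r x hx => by rw [map_smul, hx, map_smul]) fun p q h a ha b hb => ?_
    rw [hπ n ha, proj_same B.gr (n := n - p) (B.mem_deg hb (by omega))]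
    rfl
  · intro n p hne x hx
    refine tensorGr_induction hx (map_zero _) (fun x y hx hy => by rw [map_add, hx, hy, add_zero])
      (fun r x hx => by rw [map_smul, hx, smul_zero]) fun p q h a ha b hb => ?_
    rw [hπ n ha, proj_ne B.gr (by omega) hb]
    simp [tmul]
  · rw [eq_top_iff]
    intro x _
    refine tensor_induction x (zero_mem _) (fun x y hx hy => add_mem hx hy)
      fun p q a ha b hb => ?_
    exact Submodule.mem_iSup_of_mem (p + q) (tmul_mem rfl ha hb)

theorem tensor_mul_mem {m n : ℤ} {x y : A.TensorCarrier B} (hx : x ∈ A.tensorGr B m)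
    (hy : y ∈ A.tensorGr B n) : x * y ∈ A.tensorGr B (m + n) := by
  refine tensorGr_induction hx (by simp) (fun x y hx hy => by rw [add_mul]; exact add_mem hx hy)
    (fun r x hx => by rw [smul_mul_assoc]; exact Submodule.smul_mem _ r hx)
    fun p q h a ha b hb => ?_
  refine tensorGr_induction hy (by simp) (fun x y hx hy => by rw [mul_add]; exact add_mem hx hy)
    (fun r x hx => by rw [mul_smul_comm]; exact Submodule.smul_mem _ r hx)
    fun p' q' h' a' ha' b' hb' => ?_
  rw [tmul_mul_tmul a hb ha' b']
  exact Submodule.smul_mem _ _ (tmul_mem (by omega) (A.mul_mem ha ha') (B.mul_mem hb hb'))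

theorem tensorD_mem {n : ℤ} {x : A.TensorCarrier B} (hx : x ∈ A.tensorGr B n) :
    A.tensorD B x ∈ A.tensorGr B (n + 1) := by
  refine tensorGr_induction hx (by simp) (fun x y hx hy => by rw [map_add]; exact add_mem hx hy)
    (fun r x hx => by rw [map_smul]; exact Submodule.smul_mem _ r hx)
    fun p q h a ha b hb => ?_
  rw [tensorD_tmul ha]
  exact add_mem (tmul_mem (by omega) (A.d_mem ha) hb)
    (Submodule.smul_mem _ _ (tmul_mem (by omega) ha (B.d_mem hb)))

theorem tensorD_tensorD (x : A.TensorCarrier B) : A.tensorD B (A.tensorD B x) = 0 := by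
  refine tensor_induction x (by simp) (fun x y hx hy => by simp [hx, hy]) fun p q a ha b hb => ?_
  rw [tensorD_tmul ha, map_add, map_smul, tensorD_tmul ha, tensorD_tmul (A.d_mem ha), A.d_d, B.d_d,
    sg_succ]
  simp [tmul]

theorem tensorD_mul {n : ℤ} {x : A.TensorCarrier B} (hx : x ∈ A.tensorGr B n)
    (y : A.TensorCarrier B) :
    A.tensorD B (x * y) = A.tensorD B x * y + sg k n • (x * A.tensorD B y) := by
  refine tensorGr_induction hx (by simp)
    (fun x y hx hy => by rw [add_mul, map_add, hx, hy, map_add, add_mul, add_mul, smul_add]; abel)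
    (fun r x hx => by
      rw [smul_mul_assoc, map_smul, hx, map_smul, smul_mul_assoc, smul_mul_assoc, smul_add,
        smul_comm r])
    fun p q h a ha b hb => ?_
  refine tensor_induction y (by simp)
    (fun x y hx hy => by rw [mul_add, map_add, hx, hy, map_add, mul_add, mul_add, smul_add]; abel)
    fun p' q' a' ha' b' hb' => ?_
  subst h
  rw [tmul_mul_tmul a hb ha' b', map_smul, tensorD_tmul (A.mul_mem ha ha'), tensorD_tmul ha,
    tensorD_tmul ha', add_mul, mul_add, smul_mul_assoc, mul_smul_comm, tmul_mul_tmul _ hb ha',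
    tmul_mul_tmul _ (B.d_mem hb) ha', tmul_mul_tmul _ hb (A.d_mem ha'), tmul_mul_tmul _ hb ha',
    A.d_mul ha, B.d_mul hb]
  simp only [tmul, TensorProduct.add_tmul, TensorProduct.tmul_add, map_add, smul_add,
    ← TensorProduct.smul_tmul', TensorProduct.tmul_smul, map_smul, smul_smul, ← sg_add]
  have e1 : sg k (q * p' + p) = sg k (p + q + q * (p' + 1)) := sg_congr (-q) (by ring)
  have e2 : sg k (q * p' + (p + p')) = sg k (p + (q + 1) * p') := sg_congr 0 (by ring)
  have e3 : sg k (q * p' + (p + p' + q)) = sg k (p + q + (p' + q * p')) := sg_congr 0 (by ring)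
  rw [e1, e2, e3]
  abel

end Tensor

/-- The tensor product of two dg algebras. -/
def tensor (A B : DGAlg.{v, u} k) : DGAlg.{v, u} k where
  carrier := A.TensorCarrier B
  gr := A.tensorGr B
  internal := tensor_internal
  one_mem := tmul_mem (add_zero 0) A.one_mem B.one_mem
  mul_mem := tensor_mul_mem
  d := A.tensorD B
  d_mem := tensorD_mem
  d_d := tensorD_tensorD
  d_mul := tensorD_mul

/-- The enveloping algebra `Aᵉ = A ⊗ Aᵒᵖ`. -/
def env : DGAlg.{v, u} k := A.tensor A.op

/-- The map `(a, b) ↦ a ⊗ b`, `A × A → Aᵉ`. -/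
def envMk (a b : A) : A.env := GradedTensorProduct.tmul k (𝒜 := A.gr) (ℬ := A.op.gr) a (A.toOp b)

end DGAlg

/-! ### Differential graded modules -/

/-- A (left) dg module over a dg algebra. -/
structure DGMod {k : Type v} [Field k] (A : DGAlg.{v, u} k) : Type (max v (u + 1)) where
  carrier : Type u
  [addCommGroup : AddCommGroup carrier]
  [moduleBase : Module k carrier]
  [module : Module A carrier]
  [tower : IsScalarTower k A carrier]
  gr : ℤ → Submodule k carrier
  internal : DirectSum.IsInternal gr
  smul_mem : ∀ {p q : ℤ} {a : A} {m : carrier}, a ∈ A.gr p → m ∈ gr q → a • m ∈ gr (p + q)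
  d : carrier →ₗ[k] carrier
  d_mem : ∀ {p : ℤ} {m : carrier}, m ∈ gr p → d m ∈ gr (p + 1)
  d_d : ∀ m : carrier, d (d m) = 0
  d_smul : ∀ {p : ℤ} {a : A}, a ∈ A.gr p → ∀ m : carrier,
    d (a • m) = A.d a • m + sg k p • (a • d m)

namespace DGMod

variable {k : Type v} [Field k] {A : DGAlg.{v, u} k}

instance : CoeSort (DGMod A) (Type u) := ⟨DGMod.carrier⟩

instance (M : DGMod A) : AddCommGroup M := M.addCommGroup

instance (M : DGMod A) : Module k M := M.moduleBase

instance (M : DGMod A) : Module A M := M.module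

instance (M : DGMod A) : IsScalarTower k A M := M.tower

instance (M : DGMod A) : SMulCommClass A k M := IsScalarTower.to_smulCommClass' (R := k)

instance (M : DGMod A) : SMulCommClass k A M := IsScalarTower.to_smulCommClass (R := k)

instance (M : DGMod A) : DirectSum.Decomposition M.gr := M.internal.chooseDecomposition

theorem mem_deg (M : DGMod A) {p q : ℤ} {m : M} (hm : m ∈ M.gr p) (h : p = q) : m ∈ M.gr q :=
  h ▸ hm

/-- `A` as a left dg module over itself. -/
def self (A : DGAlg.{v, u} k) : DGMod A where
  carrier := A
  gr := A.gr
  internal := A.internal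
  smul_mem := A.mul_mem
  d := A.d
  d_mem := A.d_mem
  d_d := A.d_d
  d_smul := A.d_mul

/-! #### Closed morphisms of degree zero, homotopies, cohomology -/

/-- The closed morphisms of degree zero. -/
@[ext]
structure Hom (M N : DGMod A) : Type u where
  toLin : M →ₗ[A] N
  map_mem : ∀ {p : ℤ} {m : M}, m ∈ M.gr p → toLin m ∈ N.gr p
  map_d : ∀ m : M, toLin (M.d m) = N.d (toLin m)

/-- The underlying `k`-linear map. -/
def Hom.lin {M N : DGMod A} (f : Hom M N) : M →ₗ[k] N := f.toLin.restrictScalars k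

/-- The identity. -/
def Hom.id (M : DGMod A) : Hom M M := ⟨LinearMap.id, fun h => h, fun _ => rfl⟩

/-- The composition `g ∘ f`. -/
def Hom.comp {L M N : DGMod A} (g : Hom M N) (f : Hom L M) : Hom L N where
  toLin := g.toLin ∘ₗ f.toLin
  map_mem h := g.map_mem (f.map_mem h)
  map_d m := by simp [f.map_d, g.map_d]

/-- `M` and `N` are isomorphic dg modules. -/
def Iso (M N : DGMod A) : Prop :=
  ∃ (f : Hom M N) (g : Hom N M), g.comp f = Hom.id M ∧ f.comp g = Hom.id N

/-- The space `Hom_A(M, N)^n` of morphisms of degree `n`; here `A`-linearity of a morphism `f` of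
degree `n` means `f(am) = (-1)^{n|a|} a f(m)`. -/
def homGr (M N : DGMod A) (n : ℤ) : Submodule k (M →ₗ[k] N) where
  carrier := {f | (∀ (p : ℤ) (m : M), m ∈ M.gr p → f m ∈ N.gr (p + n)) ∧
    ∀ (p : ℤ) (a : A), a ∈ A.gr p → ∀ m : M, f (a • m) = sg k (n * p) • (a • f m)}
  zero_mem' := ⟨fun p m _ => zero_mem _, fun p a _ m => by simp⟩
  add_mem' {f g} hf hg := ⟨fun p m h => add_mem (hf.1 p m h) (hg.1 p m h),
    fun p a h m => by simp [hf.2 p a h m, hg.2 p a h m]⟩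
  smul_mem' r f hf := ⟨fun p m h => Submodule.smul_mem _ r (hf.1 p m h),
    fun p a h m => by
      rw [LinearMap.smul_apply, LinearMap.smul_apply, hf.2 p a h m, smul_comm r, smul_comm r]⟩

/-- The differential `d f = d ∘ f - (-1)^n f ∘ d` on morphisms of degree `n`. -/
def homD (M N : DGMod A) (n : ℤ) : (M →ₗ[k] N) →ₗ[k] (M →ₗ[k] N) :=
  LinearMap.llcomp k M N N N.d - sg k n • LinearMap.lcomp k N M.d

theorem homD_apply {M N : DGMod A} (n : ℤ) (f : M →ₗ[k] N) (m : M) :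
    homD M N n f m = N.d (f m) - sg k n • f (M.d m) := rfl

theorem homD_mem {M N : DGMod A} {n : ℤ} {f : M →ₗ[k] N} (hf : f ∈ homGr M N n) :
    homD M N n f ∈ homGr M N (n + 1) := by
  refine ⟨fun p m hm => ?_, fun p a ha m => ?_⟩
  · rw [homD_apply]
    refine sub_mem (N.mem_deg (N.d_mem (hf.1 p m hm)) (by ring)) (Submodule.smul_mem _ _ ?_)
    exact N.mem_deg (hf.1 _ _ (M.d_mem hm)) (by ring)
  · rw [homD_apply, homD_apply, hf.2 p a ha, M.d_smul ha, map_add, N.d.map_smul,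
      f.map_smul, hf.2 _ _ (A.d_mem ha), hf.2 p a ha, N.d_smul ha]
    simp only [smul_add, smul_sub, smul_smul, ← sg_add, smul_comm a (_ : k)]
    have e1 : sg k (n + n * (p + 1)) = sg k (n * p) := sg_congr n (by ring)
    have e2 : sg k (n * p + p) = sg k ((n + 1) * p) := sg_congr 0 (by ring)
    have e3 : sg k (n + (p + n * p)) = sg k ((n + 1) * p + n) := sg_congr 0 (by ring)
    rw [e1, e2, e3]
    abel

theorem homD_homD {M N : DGMod A} (n : ℤ) (f : M →ₗ[k] N) :
    homD M N (n + 1) (homD M N n f) = 0 := by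
  ext m
  simp [homD_apply, M.d_d, N.d_d, sg_succ]

/-- Two closed morphisms of degree zero are homotopic, that is, equal in `H⁰(Mod(A))`. -/
def Homotopic {M N : DGMod A} (f g : Hom M N) : Prop :=
  ∃ h ∈ homGr M N (-1), f.lin - g.lin = homD M N (-1) h

/-- The total cohomology `H(M)`. -/
abbrev Cohomology (M : DGMod A) : Type u :=
  LinearMap.ker M.d ⧸ (LinearMap.range M.d).submoduleOf (LinearMap.ker M.d)

/-- The map induced in cohomology. -/
def Hom.cohomologyMap {M N : DGMod A} (f : Hom M N) : M.Cohomology →ₗ[k] N.Cohomology :=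
  Submodule.mapQ _ _ (f.lin.restrict fun m hm => by
      rw [LinearMap.mem_ker] at hm ⊢
      exact (f.map_d m).symm.trans (by rw [hm, map_zero])) (by
    rintro ⟨m, hm⟩ ⟨l, hl⟩
    exact ⟨f.lin l, (f.map_d l).symm.trans (congrArg f.toLin hl)⟩)

/-- Quasi-isomorphisms. -/
def Hom.IsQuasiIso {M N : DGMod A} (f : Hom M N) : Prop := Function.Bijective f.cohomologyMap

/-- Acyclic dg modules. -/
def IsAcyclic (M : DGMod A) : Prop := Subsingleton M.Cohomology

/-- `P` is homotopically projective: every closed morphism of degree zero to an acyclic dg module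
is homotopic to zero. -/
def IsHProj (P : DGMod A) : Prop :=
  ∀ N : DGMod A, N.IsAcyclic → ∀ f g : Hom P N, Homotopic f g

/-! #### Shifts, cones, direct sums -/

theorem sgnMap_mul (A : DGAlg.{v, u} k) (n : ℤ) (a b : A) :
    sgnMap A.gr n (a * b) = sgnMap A.gr n a * sgnMap A.gr n b := by
  refine hom_induction A.gr a (by simp) (fun x y hx hy => by simp [add_mul, hx, hy])
    fun p a ha => ?_
  refine hom_induction A.gr b (by simp) (fun x y hx hy => by simp [mul_add, hx, hy])
    fun q b hb => ?_
  rw [sgnMap_apply _ _ ha, sgnMap_apply _ _ hb, sgnMap_apply _ _ (A.mul_mem ha hb), mul_add,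
    sg_add, smul_mul_smul_comm]

/-- The automorphism `a ↦ (-1)^{n|a|} a` of `A`. -/
def twist (A : DGAlg.{v, u} k) (n : ℤ) : A →ₐ[k] A :=
  AlgHom.ofLinearMap (sgnMap A.gr n) (by simp [sgnMap_apply _ _ A.one_mem]) (sgnMap_mul A n)

theorem twist_apply (n : ℤ) {p : ℤ} {a : A} (ha : a ∈ A.gr p) :
    twist A n a = sg k (n * p) • a := sgnMap_apply A.gr n ha

/-- The underlying space of the shift `M[n]`. -/
def ShiftCarrier (M : DGMod A) (_ : ℤ) : Type u := M.carrier

instance (M : DGMod A) (n : ℤ) : AddCommGroup (M.ShiftCarrier n) :=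
  inferInstanceAs (AddCommGroup M.carrier)

instance (M : DGMod A) (n : ℤ) : Module k (M.ShiftCarrier n) :=
  inferInstanceAs (Module k M.carrier)

instance (M : DGMod A) (n : ℤ) : Module A (M.ShiftCarrier n) :=
  Module.compHom M.carrier (twist A n).toRingHom

theorem shift_smul (M : DGMod A) (n : ℤ) (a : A) (m : M) :
    (a • (show M.ShiftCarrier n from m)) = (show M.ShiftCarrier n from twist A n a • m) := rfl

theorem shift_d_d (M : DGMod A) (n : ℤ) (m : M) : sg k n • M.d (sg k n • M.d m) = 0 := by
  rw [map_smul, M.d_d, smul_zero, smul_zero]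

theorem shift_d_smul (M : DGMod A) (n : ℤ) {p : ℤ} {a : A} (ha : a ∈ A.gr p) (m : M) :
    sg k n • M.d (twist A n a • m) =
      twist A n (A.d a) • m + sg k p • (twist A n a • (sg k n • M.d m)) := by
  rw [twist_apply n ha, twist_apply n (A.d_mem ha), smul_assoc, smul_assoc, smul_assoc,
    map_smul, M.d_smul ha, smul_add, smul_add]
  simp only [smul_smul, ← sg_add, smul_comm a (_ : k)]
  congr 2
  · exact sg_congr 0 (by ring)
  · exact sg_congr 0 (by ring)

/-- The shift `M[n]`: `M[n]^p = M^{p+n}`, with differential `(-1)^n d` and with `a` acting as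
`m ↦ (-1)^{n|a|} a m`. -/
def shift (M : DGMod A) (n : ℤ) : DGMod A where
  carrier := M.ShiftCarrier n
  tower := ⟨fun r a m => by
    change twist A n (r • a) • (show M from m) = r • (twist A n a • (show M from m))
    rw [map_smul, smul_assoc]⟩
  gr p := M.gr (p + n)
  internal := by
    refine isInternal_of_proj (M := M) _ LinearMap.id Function.injective_id
      (fun p => proj M.gr (p + n)) (fun p m hm => proj_same M.gr hm)
      (fun p q hq m hm => proj_ne M.gr (by omega) hm) ?_
    rw [← M.internal.submodule_iSup_eq_top]
    exact (Equiv.addRight n).iSup_comp (g := M.gr)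
  smul_mem {p q a m} ha hm := by
    change twist A n a • (show M from m) ∈ M.gr _
    rw [twist_apply n ha, smul_assoc]
    exact Submodule.smul_mem _ _ (M.mem_deg (M.smul_mem ha hm) (by ring))
  d := sg k n • M.d
  d_mem {p m} hm := Submodule.smul_mem _ _ (M.mem_deg (M.d_mem hm) (by ring))
  d_d := M.shift_d_d n
  d_smul ha m := M.shift_d_smul n ha m

theorem prod_internal {k : Type v} [Field k] {V W : Type u} [AddCommGroup V] [Module k V]
    [AddCommGroup W] [Module k W] {𝒱 : ℤ → Submodule k V} {𝒲 : ℤ → Submodule k W}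
    (hV : DirectSum.IsInternal 𝒱) (hW : DirectSum.IsInternal 𝒲) :
    DirectSum.IsInternal fun n => (𝒱 n).prod (𝒲 n) := by
  let _ := hV.chooseDecomposition
  let _ := hW.chooseDecomposition
  refine isInternal_of_proj _ LinearMap.id Function.injective_id
    (fun n => (proj 𝒱 n).prodMap (proj 𝒲 n)) ?_ ?_ ?_
  · rintro n ⟨x, y⟩ ⟨hx, hy⟩
    simp [proj_same 𝒱 hx, proj_same 𝒲 hy]
  · rintro n p hne ⟨x, y⟩ ⟨hx, hy⟩
    simp [proj_ne 𝒱 hne hx, proj_ne 𝒲 hne hy]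
  · rw [eq_top_iff]
    rintro ⟨x, y⟩ -
    have h1 : ((x, 0) : V × W) ∈ ⨆ n, (𝒱 n).prod (𝒲 n) := by
      refine hom_induction 𝒱 x (zero_mem _) (fun x y hx hy => ?_)
        fun p m hm => Submodule.mem_iSup_of_mem p ⟨hm, zero_mem _⟩
      simpa using add_mem hx hy
    have h2 : ((0, y) : V × W) ∈ ⨆ n, (𝒱 n).prod (𝒲 n) := by
      refine hom_induction 𝒲 y (zero_mem _) (fun x y hx hy => ?_)
        fun p m hm => Submodule.mem_iSup_of_mem p ⟨zero_mem _, hm⟩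
      simpa using add_mem hx hy
    simpa using add_mem h1 h2

/-- The direct sum `M ⊕ N`. -/
def prod (M N : DGMod A) : DGMod A where
  carrier := M × N
  gr n := (M.gr n).prod (N.gr n)
  internal := prod_internal M.internal N.internal
  smul_mem ha hm := ⟨M.smul_mem ha hm.1, N.smul_mem ha hm.2⟩
  d := M.d.prodMap N.d
  d_mem hm := ⟨M.d_mem hm.1, N.d_mem hm.2⟩
  d_d m := Prod.ext (M.d_d m.1) (N.d_d m.2)
  d_smul ha m := Prod.ext (M.d_smul ha m.1) (N.d_smul ha m.2)

/-- `f : L → M` as a map `L[1] → M`. -/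
def Hom.fromShift {L M : DGMod A} (f : Hom L M) : L.shift 1 →ₗ[k] M := f.lin

theorem cone_d_d {L M : DGMod A} (f : Hom L M) (l : L) (m : M) :
    f.lin (sg k 1 • L.d l) + M.d (f.lin l + M.d m) = 0 := by
  have h : f.lin (L.d l) = M.d (f.lin l) := f.map_d l
  rw [map_smul, map_add, M.d_d, h, sg_one]
  simp

theorem cone_d_smul {L M : DGMod A} (f : Hom L M) {p : ℤ} {a : A} (ha : a ∈ A.gr p) (l : L)
    (m : M) : f.lin (twist A 1 a • l) + M.d (a • m) =
      A.d a • m + sg k p • (a • (f.lin l + M.d m)) := by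
  have h : f.lin (a • l) = a • f.lin l := f.toLin.map_smul a l
  rw [twist_apply 1 ha, smul_assoc, one_mul, M.d_smul ha, smul_add, smul_add, map_smul, h]
  abel

/-- The cone `L[1] ⊕ M` of `f : L → M`, with differential `(l, m) ↦ (d_{L[1]} l, f(l) + d m)`. -/
def cone {L M : DGMod A} (f : Hom L M) : DGMod A where
  carrier := (L.shift 1) × M
  gr n := ((L.shift 1).gr n).prod (M.gr n)
  internal := prod_internal (L.shift 1).internal M.internal
  smul_mem ha hm := ⟨(L.shift 1).smul_mem ha hm.1, M.smul_mem ha hm.2⟩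
  d := ((L.shift 1).d ∘ₗ LinearMap.fst k _ _).prod (f.fromShift.coprod M.d)
  d_mem hm := ⟨(L.shift 1).d_mem hm.1, add_mem (f.map_mem hm.1) (M.d_mem hm.2)⟩
  d_d m := Prod.ext ((L.shift 1).d_d m.1) (cone_d_d f m.1 m.2)
  d_smul ha m := Prod.ext ((L.shift 1).d_smul ha m.1) (cone_d_smul f ha m.1 m.2)

/-! #### Perfect modules -/

/-- Finitely generated free modules: those isomorphic to a finite direct sum of shifted copies
of `A`. -/
inductive IsFGFree : DGMod A → Prop
  | zero (M : DGMod A) (h : Subsingleton M) : IsFGFree M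
  | shift (n : ℤ) : IsFGFree ((self A).shift n)
  | prod {M N : DGMod A} : IsFGFree M → IsFGFree N → IsFGFree (M.prod N)
  | iso {M N : DGMod A} : Iso M N → IsFGFree M → IsFGFree N

/-- Finitely generated semi-free modules: the smallest class of dg modules, stable by isomorphism,
which contains the finitely generated free ones and is closed under cones. -/
inductive IsFGSemiFree : DGMod A → Prop
  | free {M : DGMod A} : IsFGFree M → IsFGSemiFree M
  | cone {L M : DGMod A} (f : Hom L M) :
      IsFGSemiFree L → IsFGSemiFree M → IsFGSemiFree (cone f)
  | iso {M N : DGMod A} : Iso M N → IsFGSemiFree M → IsFGSemiFree N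

/-- Perfect modules: the homotopy direct summands of finitely generated semi-free modules. -/
def IsPerfect (L : DGMod A) : Prop :=
  ∃ N : DGMod A, IsFGSemiFree N ∧ ∃ (f : Hom N L) (g : Hom L N),
    Homotopic (f.comp g) (Hom.id L)

/-- `M` belongs to `D_per(A)`: there is a quasi-isomorphism from a perfect module to `M`. -/
def MemDPer (M : DGMod A) : Prop := ∃ (P : DGMod A) (f : Hom P M), P.IsPerfect ∧ f.IsQuasiIso

end DGMod

/-! ### Right modules, duals, bimodules -/

namespace DGMod

variable {k : Type v} [Field k]

section OfRight

variable {B : DGAlg.{v, u} k} (V : Type u) [AddCommGroup V] [Module k V]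
  (gr : ℤ → Submodule k V) (internal : DirectSum.IsInternal gr)
  (r : B →ₗ[k] V →ₗ[k] V)

/-- The left action `b • m = (-1)^{|b||m|} m b` of the opposite algebra defined by a right action
`r b m = m b`. -/
def opAct : B →ₗ[k] V →ₗ[k] V :=
  let _ := internal.chooseDecomposition
  koszul B.gr gr r

variable {V gr}

theorem opAct_apply {p q : ℤ} {b : B} {m : V} (hb : b ∈ B.gr p) (hm : m ∈ gr q) :
    opAct V gr internal r b m = sg k (p * q) • r b m :=
  let _ := internal.chooseDecomposition
  koszul_apply B.gr gr r hb hm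

/-- The action `b • m = (-1)^{|b||m|} m b` as a module structure over `Bᵒᵖ`. -/
abbrev opModule (r_one : ∀ m, r 1 m = m) (r_mul : ∀ b c m, r (b * c) m = r c (r b m))
    (r_mem : ∀ {p q : ℤ} {b : B} {m : V}, b ∈ B.gr p → m ∈ gr q → r b m ∈ gr (q + p)) :
    Module B.op V :=
    { smul := fun b m => opAct V gr internal r (B.toOp.symm b) m
      one_smul := fun m => by
        change opAct V gr internal r 1 m = m
        let _ := internal.chooseDecomposition
        refine hom_induction gr m (by simp) (fun x y hx hy => by simp [hx, hy]) fun q m hm => ?_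
        simp [opAct_apply internal r B.one_mem hm, r_one]
      mul_smul := fun b c m => by
        change opAct V gr internal r (B.opMul b c) m =
          opAct V gr internal r b (opAct V gr internal r c m)
        let _ := internal.chooseDecomposition
        change B at b c
        refine hom_induction B.gr b (by simp) (fun x y hx hy => by simp [hx, hy]) fun p b hb => ?_
        refine hom_induction B.gr c (by simp) (fun x y hx hy => by simp [hx, hy]) fun p' c hc => ?_
        refine hom_induction gr m (by simp) (fun x y hx hy => by simp [hx, hy]) fun q m hm => ?_
        rw [opAct_apply internal r (B.opMul_mem hb hc) hm, opAct_apply internal r hc hm,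
          B.opMul_apply hb hc, map_smul, map_smul, LinearMap.smul_apply, r_mul,
          opAct_apply internal r hb (r_mem hc hm), smul_smul, smul_smul, ← sg_add, ← sg_add]
        congr 1
        exact sg_congr 0 (by ring)
      smul_zero := fun b => map_zero _
      smul_add := fun b => map_add _
      add_smul := fun b c m => LinearMap.map_add₂ (opAct V gr internal r) _ _ m
      zero_smul := fun m => LinearMap.map_zero₂ (opAct V gr internal r) m }

/-- A right dg `B`-module, with action `r b m = m b`, as a left dg module over `Bᵒᵖ`, via
`b • m = (-1)^{|b||m|} m b`. -/
def ofRight (r_one : ∀ m, r 1 m = m) (r_mul : ∀ b c m, r (b * c) m = r c (r b m))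
    (r_mem : ∀ {p q : ℤ} {b : B} {m : V}, b ∈ B.gr p → m ∈ gr q → r b m ∈ gr (q + p))
    (d : V →ₗ[k] V) (d_mem : ∀ {p : ℤ} {m : V}, m ∈ gr p → d m ∈ gr (p + 1))
    (d_d : ∀ m, d (d m) = 0)
    (d_r : ∀ {q : ℤ} {m : V}, m ∈ gr q → ∀ b : B,
      d (r b m) = r b (d m) + sg k q • r (B.d b) m) : DGMod B.op where
  carrier := V
  module := opModule internal r r_one r_mul r_mem
  tower := let _ := opModule internal r r_one r_mul r_mem
    ⟨fun t b m => LinearMap.map_smul₂ (opAct V gr internal r) t _ m⟩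
  gr := gr
  internal := internal
  smul_mem {p q b m} hb hm := by
    change opAct V gr internal r (B.toOp.symm b) m ∈ _
    rw [opAct_apply (b := B.toOp.symm b) internal r hb hm, add_comm p q]
    exact Submodule.smul_mem _ _ (r_mem hb hm)
  d := d
  d_mem := d_mem
  d_d := d_d
  d_smul {p b} hb m := by
    change d (opAct V gr internal r (B.toOp.symm b) m) =
      opAct V gr internal r (B.d (B.toOp.symm b)) m +
        sg k p • opAct V gr internal r (B.toOp.symm b) (d m)
    have hb : B.toOp.symm b ∈ B.gr p := hb
    generalize B.toOp.symm b = b at hb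
    let _ := internal.chooseDecomposition
    refine hom_induction gr m (by simp)
      (fun x y hx hy => by simp only [map_add, hx, hy, smul_add]; abel) fun q m hm => ?_
    rw [opAct_apply internal r hb hm, opAct_apply internal r (B.d_mem hb) hm,
      opAct_apply internal r hb (d_mem hm), map_smul, d_r hm, smul_add, smul_smul, smul_smul,
      ← sg_add, ← sg_add, add_comm]
    congr 2
    · exact sg_congr 0 (by ring)
    · exact sg_congr (-p) (by ring)

end OfRight

section Dual

variable {B : DGAlg.{v, u} k}

/-- The left multiplication of `B` on `B`, viewed as a `B`-action on the space `Bᵒᵖ`. -/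
def lmulOp (B : DGAlg.{v, u} k) : B →ₐ[k] Module.End k (self B.op) :=
  Algebra.lmul k B

theorem lmulOp_aux {p n q : ℤ} {b c : B} (hb : b ∈ B.gr p) (hc : c ∈ B.gr q) (y : B) :
    sg k (n * q) • (b * B.opMul c y) = sg k ((p + n) * q) • B.opMul c (b * y) := by
  refine hom_induction B.gr y (by simp) (fun x y hx hy => ?_) fun r y hy => ?_
  · rw [map_add, mul_add, smul_add, hx, hy, mul_add, map_add, smul_add]
  · rw [B.opMul_apply hc hy, B.opMul_apply hc (B.mul_mem hb hy), mul_smul_comm, smul_smul,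
      smul_smul, ← sg_add, ← sg_add, mul_assoc]
    congr 1
    exact sg_congr (-(p * q)) (by ring)

theorem homGr_comp {M : DGMod B.op} {p n : ℤ} {b : B} (hb : b ∈ B.gr p)
    {f : M →ₗ[k] self B.op} (hf : f ∈ homGr M (self B.op) n) :
    lmulOp B b ∘ₗ f ∈ homGr M (self B.op) (p + n) := by
  refine ⟨fun q m hm => ?_, fun q c hc m => ?_⟩
  · exact (self B.op).mem_deg (B.mul_mem hb (hf.1 q m hm)) (by ring)
  · rw [LinearMap.comp_apply, LinearMap.comp_apply, hf.2 q c hc, map_smul]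
    exact lmulOp_aux hb hc (f m)

/-- The total space of `Hom_{Bᵒᵖ}(M, B)`, the direct sum of its homogeneous parts. -/
def dualSpace (M : DGMod B.op) : Submodule k (M →ₗ[k] self B.op) :=
  ⨆ n, homGr M (self B.op) n

theorem homGr_le (M : DGMod B.op) (n : ℤ) : homGr M (self B.op) n ≤ dualSpace M :=
  le_iSup (homGr M (self B.op)) n

theorem dualSpace_smul {M : DGMod B.op} (b : B) {f : M →ₗ[k] self B.op} (hf : f ∈ dualSpace M) :
    lmulOp B b ∘ₗ f ∈ dualSpace M := by
  refine Submodule.iSup_induction _ (motive := fun f => lmulOp B b ∘ₗ f ∈ dualSpace M) hf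
    (fun n f hf => ?_) (by simp) (fun f g hf hg => by
      rw [LinearMap.comp_add]; exact add_mem hf hg)
  refine hom_induction B.gr b (by simp) (fun x y hx hy => ?_) fun p b hb => ?_
  · rw [map_add, LinearMap.add_comp]
    exact add_mem hx hy
  · exact homGr_le M _ (homGr_comp hb hf)

/-- The graded pieces of the dual. -/
def dualGr (M : DGMod B.op) (n : ℤ) : Submodule k (dualSpace M) :=
  (homGr M (self B.op) n).comap (dualSpace M).subtype

theorem dual_iSup (M : DGMod B.op) : ⨆ n, dualGr M n = ⊤ := by
  rw [eq_top_iff]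
  rintro ⟨f, hf⟩ -
  refine Submodule.iSup_induction' _
    (motive := fun f hf => (⟨f, hf⟩ : dualSpace M) ∈ ⨆ n, dualGr M n) (fun n f hf => ?_)
    (zero_mem _) (fun f g hf' hg' hf hg => add_mem hf hg) hf
  exact Submodule.mem_iSup_of_mem n hf

theorem dual_internal (M : DGMod B.op) : DirectSum.IsInternal (dualGr M) := by
  let π (n : ℤ) : (M →ₗ[k] self B.op) →ₗ[k] (M →ₗ[k] self B.op) :=
    { toFun := fun f => byDeg M.gr fun p => proj (self B.op).gr (p + n) ∘ₗ f
      map_add' := fun f g => ext_homogeneous M.gr fun p m hm => by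
        simp [byDeg_apply M.gr _ hm]
      map_smul' := fun r f => ext_homogeneous M.gr fun p m hm => by
        simp [byDeg_apply M.gr _ hm] }
  have hπ (n : ℤ) (f : M →ₗ[k] self B.op) {p : ℤ} {m : M} (hm : m ∈ M.gr p) :
      π n f m = proj (self B.op).gr (p + n) (f m) := byDeg_apply M.gr _ hm
  refine isInternal_of_proj _ (dualSpace M).subtype Subtype.coe_injective
    (fun n => π n ∘ₗ (dualSpace M).subtype) ?_ ?_ (dual_iSup M)
  · intro n f hf
    refine ext_homogeneous M.gr fun p m hm => ?_
    exact (hπ n _ hm).trans (proj_same _ (hf.1 p m hm))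
  · intro n n' hne f hf
    refine ext_homogeneous M.gr fun p m hm => ?_
    exact (hπ n _ hm).trans (proj_ne _ (by omega) (hf.1 p m hm))

/-- The differential on the total space of the dual. -/
def dualD (M : DGMod B.op) : dualSpace M →ₗ[k] (M →ₗ[k] self B.op) :=
  let _ := (dual_internal M).chooseDecomposition
  byDeg (dualGr M) fun n => homD M (self B.op) n ∘ₗ (dualSpace M).subtype

theorem dualD_apply (M : DGMod B.op) {n : ℤ} {f : dualSpace M} (hf : f ∈ dualGr M n) :
    dualD M f = homD M (self B.op) n f.1 :=
  let _ := (dual_internal M).chooseDecomposition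
  byDeg_apply (dualGr M) _ hf

theorem dualD_mem (M : DGMod B.op) (f : dualSpace M) : dualD M f ∈ dualSpace M := by
  let _ := (dual_internal M).chooseDecomposition
  refine hom_induction (dualGr M) f (by simp)
    (fun x y hx hy => by rw [map_add]; exact add_mem hx hy) fun n f hf => ?_
  rw [dualD_apply M hf]
  exact homGr_le M _ (homD_mem hf)

theorem dual_d_smul_aux {p : ℤ} {b : B} (hb : b ∈ B.gr p) (n : ℤ) (x y : B) :
    B.d (b * x) - sg k (p + n) • (b * y) =
      B.d b * x + sg k p • (b * (B.d x - sg k n • y)) := by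
  rw [B.d_mul hb, sg_add, mul_sub, smul_sub, add_sub_assoc, mul_smul, mul_smul_comm]

/-- The action `(b φ)(m) = b φ(m)`. -/
abbrev dualModule (M : DGMod B.op) : Module B (dualSpace M) :=
    { smul := fun b f => ⟨lmulOp B b ∘ₗ f.1, dualSpace_smul b f.2⟩
      one_smul := fun f => Subtype.ext (by
        change lmulOp B 1 ∘ₗ f.1 = f.1
        rw [map_one]; rfl)
      mul_smul := fun b c f => Subtype.ext (by
        change lmulOp B (b * c) ∘ₗ f.1 = lmulOp B b ∘ₗ lmulOp B c ∘ₗ f.1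
        rw [map_mul]; rfl)
      smul_zero := fun b => Subtype.ext (LinearMap.comp_zero _)
      smul_add := fun b f g => Subtype.ext (LinearMap.comp_add _ _ _)
      add_smul := fun b c f => Subtype.ext (by
        change lmulOp B (b + c) ∘ₗ f.1 = lmulOp B b ∘ₗ f.1 + lmulOp B c ∘ₗ f.1
        rw [map_add]; rfl)
      zero_smul := fun f => Subtype.ext (by
        change lmulOp B 0 ∘ₗ f.1 = 0
        rw [map_zero]; rfl) }

/-- For a right dg `B`-module `M` (a dg `Bᵒᵖ`-module), the dg module `Hom_{Bᵒᵖ}(M, B)`, with its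
left `B`-module structure `(b φ)(m) = b φ(m)`. -/
def dual (M : DGMod B.op) : DGMod B where
  carrier := dualSpace M
  module := dualModule M
  tower := let _ := dualModule M
    ⟨fun t b f => Subtype.ext (by
      change lmulOp B (t • b) ∘ₗ f.1 = t • (lmulOp B b ∘ₗ f.1)
      rw [map_smul]; rfl)⟩
  gr := dualGr M
  internal := dual_internal M
  smul_mem hb hf := homGr_comp hb hf
  d := (dualD M).codRestrict _ (dualD_mem M)
  d_mem {n f} hf := by
    change dualD M f ∈ homGr M _ (n + 1)
    rw [dualD_apply M hf]
    exact homD_mem hf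
  d_d f := Subtype.ext <| by
    change dualD M ⟨dualD M f, dualD_mem M f⟩ = 0
    let _ := (dual_internal M).chooseDecomposition
    refine hom_induction (C := fun f => dualD M ⟨dualD M f, dualD_mem M f⟩ = 0) (dualGr M) f
      ?_ (fun f g hf hg => ?_) fun n f hf => ?_
    · simp only [map_zero]
      exact map_zero _
    · have : (⟨dualD M (f + g), dualD_mem M _⟩ : dualSpace M) =
          ⟨dualD M f, dualD_mem M f⟩ + ⟨dualD M g, dualD_mem M g⟩ := Subtype.ext (map_add _ _ _)
      rw [this, map_add, hf, hg, add_zero]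
    · have h1 : (⟨dualD M f, dualD_mem M f⟩ : dualSpace M) ∈ dualGr M (n + 1) := by
        change dualD M f ∈ homGr M _ (n + 1)
        rw [dualD_apply M hf]
        exact homD_mem hf
      refine (dualD_apply M h1).trans ?_
      change homD M _ (n + 1) (dualD M f) = 0
      rw [dualD_apply M hf, homD_homD]
  d_smul {p b} hb f := Subtype.ext <| by
    let S (b : B) (f : dualSpace M) : dualSpace M := ⟨lmulOp B b ∘ₗ f.1, dualSpace_smul b f.2⟩
    have S_add (b : B) (f g : dualSpace M) : S b (f + g) = S b f + S b g :=
      Subtype.ext (LinearMap.comp_add _ _ _)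
    change dualD M (S b f) = lmulOp B (B.d b) ∘ₗ f.1 + sg k p • (lmulOp B b ∘ₗ dualD M f)
    let _ := (dual_internal M).chooseDecomposition
    refine hom_induction (C := fun f => dualD M (S b f) =
      lmulOp B (B.d b) ∘ₗ f.1 + sg k p • (lmulOp B b ∘ₗ dualD M f)) (dualGr M) f
      ?_ (fun f g hf hg => ?_) fun n f hf => ?_
    · have : S b 0 = 0 := Subtype.ext (LinearMap.comp_zero _)
      simp [this]
    · rw [S_add, map_add, hf, hg, map_add, LinearMap.comp_add, Submodule.coe_add,
        LinearMap.comp_add, smul_add]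
      abel
    · have h1 : S b f ∈ dualGr M (p + n) := homGr_comp hb hf
      rw [dualD_apply M h1, dualD_apply M hf]
      ext m
      exact dual_d_smul_aux hb n (f.1 m) (f.1 (M.d m))

theorem homGr_precomp {M M' : DGMod B.op} (f : Hom M M') {n : ℤ} {φ : M' →ₗ[k] self B.op}
    (hφ : φ ∈ homGr M' (self B.op) n) : φ ∘ₗ f.lin ∈ homGr M (self B.op) n := by
  refine ⟨fun p m hm => hφ.1 p _ (f.map_mem hm), fun p a ha m => ?_⟩
  have h : f.lin (a • m) = a • f.lin m := f.toLin.map_smul a m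
  rw [LinearMap.comp_apply, h, hφ.2 p a ha]
  rfl

theorem dualSpace_precomp {M M' : DGMod B.op} (f : Hom M M') {φ : M' →ₗ[k] self B.op}
    (hφ : φ ∈ dualSpace M') : φ ∘ₗ f.lin ∈ dualSpace M := by
  refine Submodule.iSup_induction _ (motive := fun φ => φ ∘ₗ f.lin ∈ dualSpace M) hφ
    (fun n φ hφ => homGr_le M n (homGr_precomp f hφ)) (zero_mem _) fun φ ψ hφ hψ => ?_
  rw [LinearMap.add_comp]
  exact add_mem hφ hψ

/-- The map `Hom(M', B) → Hom(M, B)`, `φ ↦ φ ∘ f`, induced by `f : M → M'`. -/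
def dualHom {M M' : DGMod B.op} (f : Hom M M') : Hom (dual M') (dual M) where
  toLin :=
    { toFun := fun φ => (⟨φ.1 ∘ₗ f.lin, dualSpace_precomp f φ.2⟩ : dualSpace M)
      map_add' := fun _ _ => rfl
      map_smul' := fun _ _ => rfl }
  map_mem hφ := homGr_precomp f hφ
  map_d φ := Subtype.ext <| by
    change dualD M' φ ∘ₗ f.lin = dualD M ⟨φ.1 ∘ₗ f.lin, dualSpace_precomp f φ.2⟩
    let F : dualSpace M' →ₗ[k] dualSpace M :=
      { toFun := fun φ => (⟨φ.1 ∘ₗ f.lin, dualSpace_precomp f φ.2⟩ : dualSpace M)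
        map_add' := fun _ _ => rfl
        map_smul' := fun _ _ => rfl }
    change dualD M' φ ∘ₗ f.lin = dualD M (F φ)
    let _ := (dual_internal M').chooseDecomposition
    refine hom_induction (dualGr M') φ (by simp)
      (fun x y hx hy => by rw [map_add, map_add, map_add, LinearMap.add_comp, hx, hy])
      fun n φ hφ => ?_
    rw [dualD_apply M' hφ, dualD_apply M (n := n) (f := F φ) (homGr_precomp f hφ)]
    ext m
    have h : f.lin (M.d m) = M'.d (f.lin m) := f.map_d m
    exact congrArg (fun y => (self B.op).d (φ.1 (f.lin m)) - sg k n • φ.1 y) h.symm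

end Dual

section Bimodule

variable (A : DGAlg.{v, u} k)

/-- The left multiplication. -/
def actL : A →ₐ[k] Module.End k A := Algebra.lmul k A

/-- `b ↦ (x ↦ (-1)^{|b||x|} x b)`, as an algebra morphism on `Aᵒᵖ`. -/
def actR : A.op →ₐ[k] Module.End k A :=
  AlgHom.ofLinearMap (A.opMul ∘ₗ A.toOp.symm.toLinearMap)
    (LinearMap.ext fun x => A.one_opMul x)
    (fun b c => LinearMap.ext fun x => A.opMul_assoc (A.toOp.symm b) (A.toOp.symm c) x)

theorem act_comm {i j : ℤ} (a : A.gr i) (b : A.op.gr j) :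
    actL A a * actR A b = ((-1 : ℤˣ) ^ (j * i)) • (actR A b * actL A a) := by
  rw [units_smul_eq (k := k)]
  obtain ⟨a, ha⟩ := a
  obtain ⟨b, hb⟩ := b
  refine ext_homogeneous A.gr fun p x hx => ?_
  change a * A.opMul (A.toOp.symm b) x = sg k (j * i) • A.opMul (A.toOp.symm b) (a * x)
  have hb : A.toOp.symm b ∈ A.gr j := hb
  generalize A.toOp.symm b = b at hb
  rw [A.opMul_apply hb hx, A.opMul_apply hb (A.mul_mem ha hx), smul_smul, ← sg_add,
    mul_smul_comm, mul_assoc]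
  congr 1
  exact sg_congr (-(j * i)) (by ring)

/-- The action of `Aᵉ` on `A`, `(a ⊗ b) x = (-1)^{|b||x|} a x b`, as an algebra morphism. -/
def envAct : A.env →ₐ[k] Module.End k A :=
  GradedTensorProduct.lift A.gr A.op.gr (actL A) (actR A) fun _ _ a b => act_comm A a b

theorem envAct_envMk (a b x : A) : envAct A (A.envMk a b) x = a * A.opMul b x := rfl

@[elab_as_elim]
theorem env_mem_induction {n : ℤ} {C : A.env → Prop} {x : A.env} (hx : x ∈ A.env.gr n)
    (hz : C 0) (ha : ∀ x y, C x → C y → C (x + y)) (hs : ∀ (r : k) x, C x → C (r • x))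
    (hh : ∀ p q, p + q = n → ∀ a ∈ A.gr p, ∀ b ∈ A.gr q, C (A.envMk a b)) : C x :=
  DGAlg.tensorGr_induction (A := A) (B := A.op) hx hz ha hs hh

theorem env_d {p : ℤ} {a : A} (ha : a ∈ A.gr p) (b : A) :
    A.env.d (A.envMk a b) = A.envMk (A.d a) b + sg k p • A.envMk a (A.d b) :=
  DGAlg.tensorD_tmul (B := A.op) ha (A.toOp b)

/-- `A` as a left dg module over `Aᵉ`: `(a ⊗ b) x = (-1)^{|b||x|} a x b`. -/
def diag : DGMod A.env where
  carrier := A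
  module := Module.compHom A (envAct A).toRingHom
  tower := let _ := Module.compHom A (envAct A).toRingHom
    ⟨fun r x a => congrArg (fun g : Module.End k A => g a) (map_smul (envAct A) r x)⟩
  gr := A.gr
  internal := A.internal
  smul_mem {p q x m} hx hm := by
    change envAct A x m ∈ A.gr _
    refine env_mem_induction A hx (by simp) (fun x y hx hy => ?_) (fun r x hx => ?_)
      fun i j h a ha b hb => ?_
    · rw [map_add]
      exact add_mem hx hy
    · rw [map_smul]
      exact Submodule.smul_mem _ _ hx
    · rw [envAct_envMk]
      exact A.mem_deg (A.mul_mem ha (A.opMul_mem hb hm)) (by omega)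
  d := A.d
  d_mem := A.d_mem
  d_d := A.d_d
  d_smul {p x} hx m := by
    change A.d (envAct A x m) = envAct A (A.env.d x) m + sg k p • envAct A x (A.d m)
    refine env_mem_induction A hx (by simp) (fun x y hx hy => ?_) (fun r x hx => ?_)
      fun i j h a ha b hb => ?_
    · simp only [map_add, LinearMap.add_apply, hx, hy, smul_add]
      abel
    · simp only [map_smul, LinearMap.smul_apply, hx, smul_add, smul_comm r]
    · subst h
      rw [env_d A ha, map_add, map_smul, LinearMap.add_apply, LinearMap.smul_apply, envAct_envMk,
        envAct_envMk, envAct_envMk, envAct_envMk, A.d_mul ha, A.d_opMul hb, mul_add, smul_add,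
        mul_smul_comm, smul_smul, ← sg_add, add_assoc]

/-- The right action of `Aᵉ` on `Aᵒᵖ`: `x (a ⊗ b) = (-1)^{|b|(|a|+|x|)} b x a`. -/
def rightAct : A.env →ₗ[k] Module.End k A :=
  TensorProduct.lift
    (((LinearMap.llcomp k A A A).flip ∘ₗ (LinearMap.mul k A).flip).compl₂
      (koszul A.gr A.gr (LinearMap.mul k A) ∘ₗ A.toOp.symm.toLinearMap)) ∘ₗ
    (GradedTensorProduct.of k A.gr A.op.gr).symm.toLinearMap

theorem rightAct_envMk {p q r : ℤ} {a b x : A} (ha : a ∈ A.gr p) (hb : b ∈ A.gr q)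
    (hx : x ∈ A.gr r) :
    rightAct A (A.envMk a b) x = sg k (q * (p + r)) • (b * (x * a)) := by
  change koszul A.gr A.gr (LinearMap.mul k A) b (x * a) = _
  rw [koszul_apply A.gr A.gr _ hb (A.mul_mem hx ha), LinearMap.mul_apply', add_comm r p]

theorem rightAct_one (x : A) : rightAct A 1 x = x := by
  refine hom_induction A.gr x (by simp) (fun x y hx hy => by simp [hx, hy]) fun r x hx => ?_
  refine (rightAct_envMk A A.one_mem A.one_mem hx).trans ?_
  simp

theorem rightAct_mem {p q : ℤ} {y : A.env} {x : A} (hy : y ∈ A.env.gr p) (hx : x ∈ A.gr q) :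
    rightAct A y x ∈ A.gr (q + p) := by
  refine env_mem_induction A hy (by simp) (fun y z hy hz => ?_) (fun r y hy => ?_)
    fun i j h a ha b hb => ?_
  · rw [map_add]
    exact add_mem hy hz
  · rw [map_smul]
    exact Submodule.smul_mem _ _ hy
  · rw [rightAct_envMk A ha hb hx]
    exact Submodule.smul_mem _ _ (A.mem_deg (A.mul_mem hb (A.mul_mem hx ha)) (by omega))

theorem env_mul {q p' q' : ℤ} (a : A) {b a' b' : A} (hb : b ∈ A.gr q) (ha' : a' ∈ A.gr p')
    (hb' : b' ∈ A.gr q') : A.envMk a b * A.envMk a' b' =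
      sg k (q * p' + q * q') • A.envMk (a * a') (b' * b) := by
  refine (DGAlg.tmul_mul_tmul (B := A.op) a (b := A.toOp b) hb ha' (A.toOp b')).trans ?_
  rw [A.op_mul, A.opMul_apply hb hb', map_smul, GradedTensorProduct.tmul, TensorProduct.tmul_smul,
    map_smul, smul_smul, ← sg_add]
  rfl

@[elab_as_elim]
theorem env_induction {C : A.env → Prop} (x : A.env) (hz : C 0)
    (ha : ∀ x y, C x → C y → C (x + y))
    (hh : ∀ p q, ∀ a ∈ A.gr p, ∀ b ∈ A.gr q, C (A.envMk a b)) : C x :=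
  DGAlg.tensor_induction (A := A) (B := A.op) x hz ha hh

theorem rightAct_mul (y z : A.env) (x : A) :
    rightAct A (y * z) x = rightAct A z (rightAct A y x) := by
  refine hom_induction A.gr x (by simp) (fun x y hx hy => by simp [hx, hy]) fun r x hx => ?_
  refine env_induction A y (by simp) (fun y y' hy hy' => by simp [add_mul, hy, hy'])
    fun p q a ha b hb => ?_
  refine env_induction A z (by simp) (fun y y' hy hy' => by simp [mul_add, hy, hy'])
    fun p' q' a' ha' b' hb' => ?_
  rw [env_mul A a hb ha' hb', map_smul, LinearMap.smul_apply,
    rightAct_envMk A (A.mul_mem ha ha') (A.mul_mem hb' hb) hx, rightAct_envMk A ha hb hx, map_smul,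
    rightAct_envMk A ha' hb' (A.mul_mem hb (A.mul_mem hx ha)), smul_smul, smul_smul, ← sg_add,
    ← sg_add]
  congr 1
  · exact sg_congr (q * p') (by ring)
  · simp only [mul_assoc]

theorem d_rightAct {q : ℤ} {x : A} (hx : x ∈ A.gr q) (y : A.env) :
    A.d (rightAct A y x) = rightAct A y (A.d x) + sg k q • rightAct A (A.env.d y) x := by
  refine env_induction A y (by simp) (fun y y' hy hy' => ?_) fun i j a ha b hb => ?_
  · simp only [map_add, LinearMap.add_apply, hy, hy', smul_add]
    abel
  · rw [env_d A ha, map_add, map_smul, LinearMap.add_apply, LinearMap.smul_apply,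
      rightAct_envMk A ha hb hx, rightAct_envMk A ha hb (A.d_mem hx),
      rightAct_envMk A (A.d_mem ha) hb hx, rightAct_envMk A ha (A.d_mem hb) hx, map_smul,
      A.d_mul hb, A.d_mul hx, mul_add b, mul_smul_comm]
    simp only [smul_add, smul_smul, ← sg_add]
    have e1 : sg k (j * (i + q) + j) = sg k (j * (i + (q + 1))) := sg_congr 0 (by ring)
    have e2 : sg k (j * (i + q) + (j + q)) = sg k (q + j * (i + 1 + q)) := sg_congr 0 (by ring)
    have e3 : sg k (q + (i + (j + 1) * (i + q))) = sg k (j * (i + q)) := sg_congr (q + i) (by ring)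
    rw [e1, e2, e3]
    abel

/-- `Aᵒᵖ` as a right dg module over `Aᵉ`, with `x (a ⊗ b) = (-1)^{|b|(|a|+|x|)} b x a`. -/
def diagOp : DGMod A.env.op :=
  ofRight A.internal (rightAct A) (rightAct_one A) (rightAct_mul A) (rightAct_mem A) A.d A.d_mem
    A.d_d (d_rightAct A)

end Bimodule

end DGMod
/-! ### The complexes `Hom_B(M, N)` and `M ⊗_B N` -/

namespace DGMod

variable {k : Type v} [Field k] {B : DGAlg.{v, u} k}

/-- The complex of `k`-modules `Hom_B(M, N)`. -/
def homComplex (M N : DGMod B) : CochainComplex (ModuleCat.{u} k) ℤ :=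
  CochainComplex.of (fun n => ModuleCat.of k (homGr M N n))
    (fun n => ModuleCat.ofHom ((homD M N n).restrict
      (p := homGr M N n) (q := homGr M N (n + 1)) fun _ hf => homD_mem hf))
    (fun n => ModuleCat.hom_ext <| LinearMap.ext fun f => Subtype.ext (homD_homD n f.1))

theorem homComplex_d (M N : DGMod B) (n : ℤ) : (homComplex M N).d n (n + 1) =
    ModuleCat.ofHom ((homD M N n).restrict
      (p := homGr M N n) (q := homGr M N (n + 1)) fun _ hf => homD_mem hf) :=
  CochainComplex.of_d (fun n => ModuleCat.of k (homGr M N n))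
    (fun n => ModuleCat.ofHom ((homD M N n).restrict
      (p := homGr M N n) (q := homGr M N (n + 1)) fun _ hf => homD_mem hf)) n

theorem homGr_comp_lin {Q' Q N : DGMod B} (g : Hom Q' Q) {n : ℤ} {φ : Q →ₗ[k] N}
    (hφ : φ ∈ homGr Q N n) : φ ∘ₗ g.lin ∈ homGr Q' N n := by
  refine ⟨fun p m hm => hφ.1 p _ (g.map_mem hm), fun p a ha m => ?_⟩
  have h : g.lin (a • m) = a • g.lin m := g.toLin.map_smul a m
  rw [LinearMap.comp_apply, h, hφ.2 p a ha]
  rfl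

theorem homD_comp_lin {Q' Q N : DGMod B} (g : Hom Q' Q) (n : ℤ) (φ : Q →ₗ[k] N) :
    homD Q' N n (φ ∘ₗ g.lin) = homD Q N n φ ∘ₗ g.lin := by
  ext m
  have h : g.lin (Q'.d m) = Q.d (g.lin m) := g.map_d m
  rw [LinearMap.comp_apply, homD_apply, homD_apply, LinearMap.comp_apply, LinearMap.comp_apply, h]

/-- The morphism `Hom_B(Q, N) → Hom_B(Q', N)`, `φ ↦ φ ∘ g`. -/
def homComplexMap {Q' Q : DGMod B} (g : Hom Q' Q) (N : DGMod B) :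
    homComplex Q N ⟶ homComplex Q' N :=
  CochainComplex.ofHom
    (fun n => ModuleCat.ofHom ((LinearMap.lcomp k N g.lin).restrict
      (p := homGr Q N n) (q := homGr Q' N n) fun _ hφ => homGr_comp_lin g hφ))
    (fun n => by
      rw [homComplex_d, homComplex_d]
      exact ModuleCat.hom_ext <| LinearMap.ext fun φ => Subtype.ext (homD_comp_lin g n φ.1))

/-- The relations `m b ⊗ n = m ⊗ b n`, where `m b = (-1)^{|b||m|} b • m`. -/
def tensorRel (M : DGMod B.op) (N : DGMod B) : Submodule k (M ⊗[k] N) :=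
  Submodule.span k {x | ∃ p q : ℤ, ∃ b ∈ B.gr p, ∃ m ∈ M.gr q, ∃ n : N,
    x = (sg k (p * q) • (B.toOp b • m)) ⊗ₜ[k] n - m ⊗ₜ[k] (b • n)}

/-- The tensor product `M ⊗_B N` of a right and a left dg `B`-module. -/
abbrev Tensor (M : DGMod B.op) (N : DGMod B) : Type u := (M ⊗[k] N) ⧸ tensorRel M N

/-- The class of `m ⊗ n` in `M ⊗_B N`. -/
def tmk {M : DGMod B.op} {N : DGMod B} (m : M) (n : N) : Tensor M N :=
  (tensorRel M N).mkQ (m ⊗ₜ[k] n)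

/-- The component of degree `n` of `M ⊗_B N`. -/
def tensorGr (M : DGMod B.op) (N : DGMod B) (n : ℤ) : Submodule k (Tensor M N) :=
  Submodule.span k {x | ∃ p q : ℤ, p + q = n ∧ ∃ a ∈ M.gr p, ∃ b ∈ N.gr q, x = tmk a b}

/-- The differential `d (m ⊗ n) = dm ⊗ n + (-1)^{|m|} m ⊗ dn` on `M ⊗_k N`. -/
def preD (M : DGMod B.op) (N : DGMod B) : M ⊗[k] N →ₗ[k] M ⊗[k] N :=
  TensorProduct.map M.d LinearMap.id + TensorProduct.map (sgnMap M.gr 1) N.d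

theorem preD_tmul {M : DGMod B.op} {N : DGMod B} {p : ℤ} {m : M} (hm : m ∈ M.gr p) (n : N) :
    preD M N (m ⊗ₜ n) = M.d m ⊗ₜ n + sg k p • (m ⊗ₜ N.d n) := by
  simp [preD, sgnMap_apply M.gr 1 hm, ← TensorProduct.smul_tmul']

theorem mem_tensorRel {M : DGMod B.op} {N : DGMod B} {p q : ℤ} {b : B} (hb : b ∈ B.gr p) {m : M}
    (hm : m ∈ M.gr q) (n : N) :
    sg k (p * q) • ((B.toOp b • m) ⊗ₜ[k] n) - m ⊗ₜ[k] (b • n) ∈ tensorRel M N :=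
  Submodule.subset_span ⟨p, q, b, hb, m, hm, n, by rw [TensorProduct.smul_tmul']⟩

theorem preD_rel (M : DGMod B.op) (N : DGMod B) :
    tensorRel M N ≤ (tensorRel M N).comap (preD M N) := by
  refine Submodule.span_le.2 ?_
  rintro _ ⟨p, q, b, hb, m, hm, n, rfl⟩
  have hb' : B.toOp b ∈ B.op.gr p := hb
  rw [SetLike.mem_coe, Submodule.mem_comap, ← TensorProduct.smul_tmul', map_sub, map_smul,
    preD_tmul (M.smul_mem hb' hm), preD_tmul hm, M.d_smul hb', N.d_smul hb]
  have h1 := Submodule.smul_mem _ (sg k q) (mem_tensorRel (N := N) (B.d_mem hb) hm n)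
  have h2 := mem_tensorRel (N := N) hb (M.d_mem hm) n
  have h3 := Submodule.smul_mem _ (sg k (p + q)) (mem_tensorRel (N := N) hb hm (N.d n))
  convert add_mem (add_mem h1 h2) h3 using 1
  rw [B.op_d]
  simp only [TensorProduct.add_tmul, TensorProduct.tmul_add, TensorProduct.tmul_smul,
    ← TensorProduct.smul_tmul', smul_add, smul_sub, smul_smul, ← sg_add]
  have e1 : sg k (q + (p + 1) * q) = sg k (p * q) := sg_congr q (by ring)
  have e2 : sg k (p * (q + 1)) = sg k (p * q + p) := sg_congr 0 (by ring)
  have e3 : sg k (p + q + p * q) = sg k (p * q + (p + q)) := sg_congr 0 (by ring)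
  have e4 : sg k (p + q) = sg k (q + p) := sg_congr 0 (by ring)
  rw [e1, e2, e3, e4]
  abel

/-- The differential of `M ⊗_B N`. -/
def tensorD (M : DGMod B.op) (N : DGMod B) : Tensor M N →ₗ[k] Tensor M N :=
  (tensorRel M N).mapQ (tensorRel M N) (preD M N) (preD_rel M N)

theorem tensorD_tmk {M : DGMod B.op} {N : DGMod B} {p : ℤ} {m : M} (hm : m ∈ M.gr p) (n : N) :
    tensorD M N (tmk m n) = tmk (M.d m) n + sg k p • tmk m (N.d n) := by
  change (tensorRel M N).mkQ (preD M N (m ⊗ₜ n)) = _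
  rw [preD_tmul hm, map_add, map_smul]
  rfl

theorem tmk_mem {M : DGMod B.op} {N : DGMod B} {p q n : ℤ} (h : p + q = n) {a : M}
    (ha : a ∈ M.gr p) {b : N} (hb : b ∈ N.gr q) : tmk a b ∈ tensorGr M N n :=
  Submodule.subset_span ⟨p, q, h, a, ha, b, hb, rfl⟩

@[elab_as_elim]
theorem tensorGr_induction {M : DGMod B.op} {N : DGMod B} {n : ℤ} {C : Tensor M N → Prop}
    {x : Tensor M N} (hx : x ∈ tensorGr M N n) (hz : C 0) (ha : ∀ x y, C x → C y → C (x + y))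
    (hs : ∀ (r : k) x, C x → C (r • x))
    (hh : ∀ p q, p + q = n → ∀ a ∈ M.gr p, ∀ b ∈ N.gr q, C (tmk a b)) : C x := by
  refine Submodule.span_induction ?_ hz (fun x y _ _ => ha x y) (fun r x _ => hs r x) hx
  rintro _ ⟨p, q, h, a, hp, b, hq, rfl⟩
  exact hh p q h a hp b hq

theorem tensorD_mem {M : DGMod B.op} {N : DGMod B} {n : ℤ} {x : Tensor M N}
    (hx : x ∈ tensorGr M N n) : tensorD M N x ∈ tensorGr M N (n + 1) := by
  refine tensorGr_induction hx (by rw [map_zero]; exact zero_mem _)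
    (fun x y hx hy => by rw [map_add]; exact add_mem hx hy)
    (fun r x hx => by rw [map_smul]; exact Submodule.smul_mem _ r hx)
    fun p q h a ha b hb => ?_
  rw [tensorD_tmk ha]
  exact add_mem (tmk_mem (by omega) (M.d_mem ha) hb)
    (Submodule.smul_mem _ _ (tmk_mem (by omega) ha (N.d_mem hb)))

theorem tmk_zero_left {M : DGMod B.op} {N : DGMod B} (n : N) : tmk (0 : M) n = 0 := by
  simp [tmk]

theorem tmk_zero_right {M : DGMod B.op} {N : DGMod B} (m : M) : tmk m (0 : N) = 0 := by
  simp [tmk]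

theorem tensorD_tensorD {M : DGMod B.op} {N : DGMod B} {n : ℤ} {x : Tensor M N}
    (hx : x ∈ tensorGr M N n) : tensorD M N (tensorD M N x) = 0 := by
  refine tensorGr_induction hx (by simp only [map_zero])
    (fun x y hx hy => by rw [map_add, map_add, hx, hy, add_zero])
    (fun r x hx => by rw [map_smul, map_smul, hx, smul_zero])
    fun p q h a ha b hb => ?_
  rw [tensorD_tmk ha, map_add, map_smul, tensorD_tmk ha, tensorD_tmk (M.d_mem ha), M.d_d, N.d_d,
    sg_succ, tmk_zero_left, tmk_zero_right]
  simp

/-- The complex of `k`-modules `M ⊗_B N`. -/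
def tensorComplex (M : DGMod B.op) (N : DGMod B) : CochainComplex (ModuleCat.{u} k) ℤ :=
  CochainComplex.of (fun n => ModuleCat.of k (tensorGr M N n))
    (fun n => ModuleCat.ofHom ((tensorD M N).restrict
      (p := tensorGr M N n) (q := tensorGr M N (n + 1)) fun _ hx => tensorD_mem hx))
    (fun _ => ModuleCat.hom_ext <| LinearMap.ext fun x => Subtype.ext (tensorD_tensorD x.2))

theorem tensorComplex_d (M : DGMod B.op) (N : DGMod B) (n : ℤ) :
    (tensorComplex M N).d n (n + 1) =
      ModuleCat.ofHom ((tensorD M N).restrict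
        (p := tensorGr M N n) (q := tensorGr M N (n + 1)) fun _ hx => tensorD_mem hx) :=
  CochainComplex.of_d (fun n => ModuleCat.of k (tensorGr M N n))
    (fun n => ModuleCat.ofHom ((tensorD M N).restrict
      (p := tensorGr M N n) (q := tensorGr M N (n + 1)) fun _ hx => tensorD_mem hx)) n

theorem tensorMap_rel {M M' : DGMod B.op} (f : Hom M M') (N : DGMod B) :
    tensorRel M N ≤ (tensorRel M' N).comap (TensorProduct.map f.lin LinearMap.id) := by
  refine Submodule.span_le.2 ?_
  rintro _ ⟨p, q, b, hb, m, hm, n, rfl⟩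
  have h : f.lin (B.toOp b • m) = B.toOp b • f.lin m := f.toLin.map_smul _ m
  have h' := mem_tensorRel (N := N) hb (f.map_mem hm) n
  rw [SetLike.mem_coe, Submodule.mem_comap, map_sub, TensorProduct.map_tmul,
    TensorProduct.map_tmul, map_smul, h, ← TensorProduct.smul_tmul']
  exact h'

/-- The map `M ⊗_B N → M' ⊗_B N`, `m ⊗ n ↦ f(m) ⊗ n`. -/
def tensorMap {M M' : DGMod B.op} (f : Hom M M') (N : DGMod B) : Tensor M N →ₗ[k] Tensor M' N :=
  (tensorRel M N).mapQ (tensorRel M' N) (TensorProduct.map f.lin LinearMap.id) (tensorMap_rel f N)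

theorem tensorMap_tmk {M M' : DGMod B.op} (f : Hom M M') {N : DGMod B} (m : M) (n : N) :
    tensorMap f N (tmk m n) = tmk (f.lin m) n := rfl

theorem tensorMap_mem {M M' : DGMod B.op} (f : Hom M M') {N : DGMod B} {n : ℤ} {x : Tensor M N}
    (hx : x ∈ tensorGr M N n) : tensorMap f N x ∈ tensorGr M' N n := by
  refine tensorGr_induction hx (by rw [map_zero]; exact zero_mem _)
    (fun x y hx hy => by rw [map_add]; exact add_mem hx hy)
    (fun r x hx => by rw [map_smul]; exact Submodule.smul_mem _ r hx)
    fun p q h a ha b hb => ?_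
  rw [tensorMap_tmk]
  exact tmk_mem h (f.map_mem ha) hb

theorem tensorMap_d {M M' : DGMod B.op} (f : Hom M M') {N : DGMod B} {n : ℤ} {x : Tensor M N}
    (hx : x ∈ tensorGr M N n) : tensorD M' N (tensorMap f N x) = tensorMap f N (tensorD M N x) := by
  refine tensorGr_induction hx (by simp only [map_zero])
    (fun x y hx hy => by simp only [map_add, hx, hy])
    (fun r x hx => by simp only [map_smul, hx])
    fun p q h a ha b hb => ?_
  have h : f.lin (M.d a) = M'.d (f.lin a) := f.map_d a
  rw [tensorMap_tmk, tensorD_tmk (m := f.lin a) (f.map_mem ha), tensorD_tmk ha, map_add, map_smul, tensorMap_tmk,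
    tensorMap_tmk, h]

/-- The morphism of complexes `M ⊗_B N → M' ⊗_B N` induced by `f : M → M'`. -/
def tensorComplexMap {M M' : DGMod B.op} (f : Hom M M') (N : DGMod B) :
    tensorComplex M N ⟶ tensorComplex M' N :=
  CochainComplex.ofHom
    (fun n => ModuleCat.ofHom ((tensorMap f N).restrict
      (p := tensorGr M N n) (q := tensorGr M' N n) fun _ hx => tensorMap_mem f hx))
    (fun n => by
      rw [tensorComplex_d, tensorComplex_d]
      exact ModuleCat.hom_ext <| LinearMap.ext fun x => Subtype.ext (tensorMap_d f x.2))

/-! ### The evaluation morphism -/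

section Eval

variable {P : DGMod B.op} {Q : DGMod B} (π : Hom Q (dual P)) (N : DGMod B)

/-- The morphism `π q : P → B`. -/
def evalAt : Q →ₗ[k] P →ₗ[k] B where
  toFun q := B.toOp.symm.toLinearMap ∘ₗ (show dualSpace P from π.lin q).1
  map_add' q q' := by rw [map_add]; rfl
  map_smul' r q := by rw [map_smul]; rfl

theorem evalAt_mem {l i : ℤ} {q : Q} (hq : q ∈ Q.gr l) {p : P} (hp : p ∈ P.gr i) :
    evalAt π q p ∈ B.gr (i + l) :=
  (π.map_mem hq).1 i p hp

/-- `(π q)(p b) = (π q)(p) b`. -/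
theorem evalAt_op_smul {l i j : ℤ} {q : Q} (hq : q ∈ Q.gr l) {p : P} (hp : p ∈ P.gr i) {b : B}
    (hb : b ∈ B.gr j) :
    sg k (j * i) • evalAt π q (B.toOp b • p) = evalAt π q p * b := by
  have h : evalAt π q (B.toOp b • p) = sg k (l * j) • B.opMul b (evalAt π q p) :=
    (π.map_mem hq).2 j (B.toOp b) hb p
  rw [h, B.opMul_apply hb (evalAt_mem π hq hp), smul_smul, smul_smul, ← sg_add, ← sg_add,
    sg_congr (m := j * i + l * j + j * (i + l)) (n := 0) (j * i + l * j) (by ring), sg_zero,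
    one_smul]

theorem evalAt_smul (b : B) (q : Q) (p : P) : evalAt π (b • q) p = b * evalAt π q p := by
  have h : π.lin (b • q) = b • π.lin q := π.toLin.map_smul b q
  change B.toOp.symm ((show dualSpace P from π.lin (b • q)).1 p) = _
  rw [h]
  rfl

/-- `d ((π q)(p)) = (π dq)(p) + (-1)^{|q|} (π q)(dp)`. -/
theorem d_evalAt {l : ℤ} {q : Q} (hq : q ∈ Q.gr l) (p : P) :
    B.d (evalAt π q p) = evalAt π (Q.d q) p + sg k l • evalAt π q (P.d p) := by
  have h : π.lin (Q.d q) = (dual P).d (π.lin q) := π.map_d q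
  have h2 : evalAt π (Q.d q) p = homD P (self B.op) l (show dualSpace P from π.lin q).1 p := by
    change B.toOp.symm ((show dualSpace P from π.lin (Q.d q)).1 p) = _
    rw [h]
    change dualD P (show dualSpace P from π.lin q) p = _
    rw [dualD_apply P (n := l) (f := π.lin q) (π.map_mem hq)]
  rw [h2]
  exact (sub_add_cancel (B.d (evalAt π q p)) (sg k l • evalAt π q (P.d p))).symm

/-- The bilinear map `(q, p ⊗ n) ↦ (-1)^{|q|(|p|+|n|)} (π q)(p) n`. -/
def preEval : Q →ₗ[k] P ⊗[k] N →ₗ[k] N :=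
  byDeg Q.gr fun l =>
    LinearMap.lcomp k N (TensorProduct.map (sgnMap P.gr l) (sgnMap N.gr l)) ∘ₗ
      TensorProduct.uncurry (RingHom.id k) P N N ∘ₗ
        (LinearMap.llcomp k P B (Module.End k N) (Algebra.lsmul k k N).toLinearMap) ∘ₗ evalAt π

theorem preEval_tmul {l i j : ℤ} {q : Q} (hq : q ∈ Q.gr l) {p : P} (hp : p ∈ P.gr i) {n : N}
    (hn : n ∈ N.gr j) :
    preEval π N q (p ⊗ₜ n) = sg k (l * (i + j)) • (evalAt π q p • n) := by
  rw [preEval, byDeg_apply Q.gr _ hq]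
  change evalAt π q (sgnMap P.gr l p) • (sgnMap N.gr l n) = _
  rw [sgnMap_apply P.gr l hp, sgnMap_apply N.gr l hn, map_smul, smul_assoc, smul_comm _ (sg k (l * j)),
    smul_smul, ← sg_add, mul_add]

theorem preEval_rel (q : Q) : tensorRel P N ≤ LinearMap.ker (preEval π N q) := by
  refine hom_induction Q.gr q (by simp) (fun x y hx hy z hz => ?_) fun l q hq => ?_
  · have h1 : preEval π N x z = 0 := hx hz
    have h2 : preEval π N y z = 0 := hy hz
    rw [LinearMap.mem_ker, map_add, LinearMap.add_apply, h1, h2, add_zero]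
  · refine Submodule.span_le.2 ?_
    rintro _ ⟨j, i, b, hb, p, hp, n, rfl⟩
    rw [SetLike.mem_coe, LinearMap.mem_ker, map_sub, sub_eq_zero, ← TensorProduct.smul_tmul',
      map_smul]
    refine hom_induction N.gr n (by simp)
      (fun x y hx hy => by rw [TensorProduct.tmul_add, map_add, smul_add, hx, hy, smul_add,
        TensorProduct.tmul_add, map_add]) fun r n hn => ?_
    have hb' : B.toOp b ∈ B.op.gr j := hb
    rw [preEval_tmul π N hq (P.smul_mem hb' hp) hn, preEval_tmul π N hq hp (N.smul_mem hb hn),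
      smul_smul (evalAt π q p) b n, ← evalAt_op_smul π hq hp hb, smul_assoc, smul_smul, smul_smul,
      ← sg_add, ← sg_add]
    congr 1
    exact sg_congr 0 (by ring)

/-- The map `P ⊗_B N → Hom(Q, N)`, `p ⊗ n ↦ (q ↦ (-1)^{|q|(|p|+|n|)} (π q)(p) n)`. -/
def eval : Tensor P N →ₗ[k] Q →ₗ[k] N :=
  (tensorRel P N).liftQ (preEval π N).flip fun _ hx => LinearMap.ext fun q =>
    preEval_rel π N q hx

theorem eval_tmk {l i j : ℤ} {p : P} (hp : p ∈ P.gr i) {n : N} (hn : n ∈ N.gr j) {q : Q}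
    (hq : q ∈ Q.gr l) :
    eval π N (tmk p n) q = sg k (l * (i + j)) • (evalAt π q p • n) :=
  preEval_tmul π N hq hp hn

theorem eval_mem {n : ℤ} {x : Tensor P N} (hx : x ∈ tensorGr P N n) :
    eval π N x ∈ homGr Q N n := by
  refine tensorGr_induction hx (by rw [map_zero]; exact zero_mem _)
    (fun x y hx hy => by rw [map_add]; exact add_mem hx hy)
    (fun r x hx => by rw [map_smul]; exact Submodule.smul_mem _ r hx)
    fun i j h a ha b hb => ⟨fun l q hq => ?_, fun m c hc q => ?_⟩
  · rw [eval_tmk π N ha hb hq]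
    exact Submodule.smul_mem _ _ (N.mem_deg (N.smul_mem (evalAt_mem π hq ha) hb) (by omega))
  · refine hom_induction Q.gr q (by simp)
      (fun x y hx hy => by rw [smul_add, map_add, map_add, smul_add, smul_add, hx, hy])
      fun l q hq => ?_
    rw [eval_tmk π N ha hb hq, eval_tmk π N ha hb (Q.smul_mem hc hq), evalAt_smul, mul_smul,
      smul_comm c (_ : k), smul_smul (sg k (n * m)), ← sg_add, ← h]
    congr 1
    exact sg_congr 0 (by ring)

theorem eval_d {n : ℤ} {x : Tensor P N} (hx : x ∈ tensorGr P N n) :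
    homD Q N n (eval π N x) = eval π N (tensorD P N x) := by
  refine tensorGr_induction hx (by simp only [map_zero])
    (fun x y hx hy => by simp only [map_add, hx, hy])
    (fun r x hx => by simp only [map_smul, hx])
    fun i j h a ha b hb => ?_
  refine ext_homogeneous Q.gr fun l q hq => ?_
  rw [homD_apply, tensorD_tmk ha, map_add, map_smul, LinearMap.add_apply, LinearMap.smul_apply,
    eval_tmk π N ha hb hq, eval_tmk π N ha hb (Q.d_mem hq), eval_tmk π N (P.d_mem ha) hb hq,
    eval_tmk π N ha (N.d_mem hb) hq, map_smul, N.d_smul (evalAt_mem π hq ha), d_evalAt π hq,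
    add_smul, smul_assoc]
  simp only [smul_add, smul_smul, ← sg_add]
  subst h
  have e1 : sg k (i + j + (l + 1) * (i + j)) = sg k (l * (i + j)) := sg_congr (i + j) (by ring)
  have e2 : sg k (l * (i + j) + l) = sg k (l * (i + 1 + j)) := sg_congr 0 (by ring)
  have e3 : sg k (l * (i + j) + (i + l)) = sg k (i + l * (i + (j + 1))) := sg_congr 0 (by ring)
  rw [e1, e2, e3]
  abel

/-- The evaluation morphism of complexes `P ⊗_B N → Hom_B(Q, N)`,
`p ⊗ n ↦ (q ↦ (-1)^{|q|(|p|+|n|)} (π q)(p) n)`, defined by a morphism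
`π : Q → Hom_{Bᵒᵖ}(P, B)`. -/
def evalComplex : tensorComplex P N ⟶ homComplex Q N :=
  CochainComplex.ofHom
    (fun n => ModuleCat.ofHom ((eval π N).restrict
      (p := tensorGr P N n) (q := homGr Q N n) fun _ hx => eval_mem π N hx))
    (fun n => by
      rw [homComplex_d, tensorComplex_d]
      exact ModuleCat.hom_ext <| LinearMap.ext fun x => Subtype.ext (eval_d π N x.2))

end Eval

/-! ### Resolutions -/

/-- A homotopically projective resolution of a dg module. -/
structure HProjRes (M : DGMod B) : Type (max v (u + 1)) where
  P : DGMod B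
  π : Hom P M
  hproj : P.IsHProj
  quasiIso : π.IsQuasiIso

end DGMod

namespace DGAlg

variable {k : Type v} [Field k] (A : DGAlg.{v, u} k)

/-- `A` is proper: its total cohomology has finite dimension. -/
def IsProper : Prop := FiniteDimensional k (DGMod.self A).Cohomology

/-- `A` is homologically smooth: `A ∈ D_per(Aᵉ)`. -/
def IsHomologicallySmooth : Prop := (DGMod.diag A).MemDPer

/-- The dg `Aᵉ`-module `Hom_{Aᵉ}(P, Aᵉ)`, which represents
`ω_A⁻¹ = RHom_{Aᵉ}(Aᵒᵖ, Aᵉ)` when `P` is a homotopically projective resolution of the right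
`Aᵉ`-module `Aᵒᵖ`. -/
abbrev invOmega {A : DGAlg.{v, u} k} (R : (DGMod.diagOp A).HProjRes) : DGMod A.env :=
  DGMod.dual R.P

/-- The complex `P ⊗_{Aᵉ} A`, which represents `Aᵒᵖ ⊗ᴸ_{Aᵉ} A`. -/
abbrev hochschild {A : DGAlg.{v, u} k} (R : (DGMod.diagOp A).HProjRes) :
    CochainComplex (ModuleCat.{u} k) ℤ :=
  DGMod.tensorComplex R.P (DGMod.diag A)

/-- The complex `Hom_{Aᵉ}(Q, A)`, which represents `RHom_{Aᵉ}(ω_A⁻¹, A)` when `Q` is a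
homotopically projective resolution of `ω_A⁻¹`. -/
abbrev rhomInvOmega {A : DGAlg.{v, u} k} {R : (DGMod.diagOp A).HProjRes}
    (S : (invOmega R).HProjRes) : CochainComplex (ModuleCat.{u} k) ℤ :=
  DGMod.homComplex S.P (DGMod.diag A)

/-- The canonical morphism `P ⊗_{Aᵉ} A → Hom_{Aᵉ}(Q, A)`,
`p ⊗ a ↦ (q ↦ ± (π q)(p) a)`. -/
abbrev hochschildEval {A : DGAlg.{v, u} k} {R : (DGMod.diagOp A).HProjRes}
    (S : (invOmega R).HProjRes) : hochschild R ⟶ rhomInvOmega S :=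
  DGMod.evalComplex S.π (DGMod.diag A)

end DGAlg

end DG

end

/-!
Write `B` for `Aᵉ`. The evaluation `P ⊗_B N → Hom_B(Hom_{Bᵒᵖ}(P, B), N)` is an isomorphism of
complexes as soon as the graded module underlying `P` is free of finite rank: in terms of a
homogeneous basis `e` of `P` and the dual basis, both sides consist of families of elements of `N`
indexed by the basis (`HomogBasis.isIso_evalComplex`). The differential of `P` does not matter.

A finitely generated semi-free module has such a basis which is moreover filtered, in the sense that
`d (e i)` is a combination of basis elements of smaller rank (`IsFGSemiFree.hasFilteredBasis`).
Modules with a filtered basis are homotopically projective, since homotopies can be constructed by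
induction on the rank (`HasFilteredBasis.isHProj`), and so are their duals, because the dual basis
is filtered by the opposite ranks (`HasFilteredBasis.dual`).

Duality preserves homotopies, and `- ⊗ N` and `Hom(-, N)` send homotopic morphisms to morphisms
which are equal in the derived category (`Homotopic.dualHom`, `Homotopic.map_tensorComplexMap`,
`Homotopic.map_homComplexMap`), so these statements pass to homotopy retracts, that is, to perfect modules (`IsBasedPerfect`). The exchange
of the factors identifies the opposite of `Aᵉ` with `Aᵉ`, and the right module `Aᵒᵖ` with the left
module `A`; smoothness therefore provides a perfect resolution of `Aᵒᵖ`
(`exists_isBasedPerfect_resolution`). Any other homotopically projective resolution `P` is a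
homotopy retract of it, so that its dual is homotopically projective, any homotopically projective
resolution `Q` of the dual is homotopy equivalent to the dual, and the evaluation
`P ⊗ A → Hom(Q, A)` is an isomorphism in the derived category
(`IsBasedPerfect.isIso_map_evalComplex`). Comparison maps exist because morphisms from homotopically
projective modules lift along quasi-isomorphisms (`IsHProj.exists_lift`), and the squares commute
because the evaluation is strictly natural and `Hom(-, A)` identifies homotopic morphisms
(`evalComplex_naturality`).
-/

noncomputable section

namespace DG

/-! ### Homotopies and homotopically projective modules -/

namespace DGMod

variable {k : Type v} [Field k] {B : DGAlg.{v, u} k}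

theorem Hom.lin_mem {M N : DGMod B} (f : Hom M N) : f.lin ∈ homGr M N 0 :=
  ⟨fun p m hm => N.mem_deg (f.map_mem hm) (add_zero p).symm, fun p a _ m => by
    rw [zero_mul, sg_zero, one_smul]
    exact f.toLin.map_smul a m⟩

theorem Hom.lin_d {M N : DGMod B} (f : Hom M N) (m : M) : f.lin (M.d m) = N.d (f.lin m) :=
  f.map_d m

theorem Hom.lin_smul {M N : DGMod B} (f : Hom M N) (b : B) (m : M) :
    f.lin (b • m) = b • f.lin m := f.toLin.map_smul b m

theorem Hom.homD_lin {M N : DGMod B} (f : Hom M N) : homD M N 0 f.lin = 0 := by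
  ext m
  simp [homD_apply, f.lin_d]

theorem Homotopic.apply {M N : DGMod B} {f g : Hom M N} {h : M →ₗ[k] N}
    (e : f.lin - g.lin = homD M N (-1) h) (m : M) :
    f.lin m - g.lin m = N.d (h m) + h (M.d m) := by
  have := LinearMap.congr_fun e m
  rw [homD_apply] at this
  simpa [sg] using this

theorem homotopic_of_apply {M N : DGMod B} {f g : Hom M N} {h : M →ₗ[k] N}
    (hh : h ∈ homGr M N (-1)) (e : ∀ m, f.lin m - g.lin m = N.d (h m) + h (M.d m)) :
    Homotopic f g := by
  refine ⟨h, hh, LinearMap.ext fun m => ?_⟩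
  rw [homD_apply]
  simpa [sg] using e m

theorem Homotopic.refl {M N : DGMod B} (f : Hom M N) : Homotopic f f :=
  ⟨0, zero_mem _, by simp⟩

theorem Homotopic.symm {M N : DGMod B} {f g : Hom M N} : Homotopic f g → Homotopic g f := by
  rintro ⟨h, hh, e⟩
  exact ⟨-h, neg_mem hh, by rw [map_neg, ← e, neg_sub]⟩

theorem Homotopic.trans {M N : DGMod B} {f g l : Hom M N} :
    Homotopic f g → Homotopic g l → Homotopic f l := by
  rintro ⟨h, hh, e⟩ ⟨h', hh', e'⟩
  exact ⟨h + h', add_mem hh hh', by rw [map_add, ← e, ← e', sub_add_sub_cancel]⟩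

theorem homGr_lin_comp {M N L : DGMod B} (g : Hom N L) {n : ℤ} {φ : M →ₗ[k] N}
    (hφ : φ ∈ homGr M N n) : g.lin ∘ₗ φ ∈ homGr M L n := by
  refine ⟨fun p m hm => g.map_mem (hφ.1 p m hm), fun p a ha m => ?_⟩
  rw [LinearMap.comp_apply, hφ.2 p a ha, map_smul, g.lin_smul]
  rfl

theorem Homotopic.comp_left {M N L : DGMod B} {f g : Hom M N} (l : Hom N L) :
    Homotopic f g → Homotopic (l.comp f) (l.comp g) := by
  rintro ⟨h, hh, e⟩
  refine homotopic_of_apply (homGr_lin_comp l hh) fun m => ?_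
  change l.lin (f.lin m) - l.lin (g.lin m) = _
  rw [← map_sub, Homotopic.apply e, map_add, l.lin_d]
  rfl

theorem Homotopic.comp_right {M N L : DGMod B} {f g : Hom M N} (l : Hom L M) :
    Homotopic f g → Homotopic (f.comp l) (g.comp l) := by
  rintro ⟨h, hh, e⟩
  refine homotopic_of_apply (homGr_comp_lin l hh) fun m => ?_
  change f.lin (l.lin m) - g.lin (l.lin m) = _
  rw [Homotopic.apply e, ← l.lin_d]
  rfl

/-- A homotopy retract of a homotopically projective module is homotopically projective. -/
theorem IsHProj.of_retract {P F : DGMod B} (hF : F.IsHProj) (f : Hom F P) (g : Hom P F)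
    (h : Homotopic (f.comp g) (Hom.id P)) : P.IsHProj := fun N hN a b =>
  ((h.comp_left a).symm.trans ((hF N hN (a.comp f) (b.comp f)).comp_right g)).trans
    (h.comp_left b)

theorem IsAcyclic.exists_primitive {N : DGMod B} (hN : N.IsAcyclic) {x : N} (hx : N.d x = 0) :
    ∃ y, N.d y = x := by
  have h : (Submodule.Quotient.mk ⟨x, hx⟩ : N.Cohomology) = 0 := hN.elim _ _
  rw [Submodule.Quotient.mk_eq_zero] at h
  exact h

theorem d_proj (N : DGMod B) (p : ℤ) (y : N) : N.d (proj N.gr p y) = proj N.gr (p + 1) (N.d y) := by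
  refine hom_induction N.gr y (by simp) (fun x y hx hy => by simp [hx, hy]) fun q y hy => ?_
  by_cases h : q = p
  · subst h
    rw [proj_same N.gr hy, proj_same N.gr (N.d_mem hy)]
  · rw [proj_ne N.gr h hy, proj_ne N.gr (p := q + 1) (by omega) (N.d_mem hy), map_zero]

theorem proj_mem (N : DGMod B) (p : ℤ) (y : N) : proj N.gr p y ∈ N.gr p := by
  refine hom_induction N.gr y (by simp) (fun x y hx hy => by rw [map_add]; exact add_mem hx hy)
    fun q y hy => ?_
  by_cases h : q = p
  · subst h
    rwa [proj_same N.gr hy]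
  · rw [proj_ne N.gr h hy]
    exact zero_mem _

theorem IsAcyclic.exists_homogeneous_primitive {N : DGMod B} (hN : N.IsAcyclic) {p : ℤ} {x : N}
    (hx : x ∈ N.gr p) (hd : N.d x = 0) : ∃ y ∈ N.gr (p - 1), N.d y = x := by
  obtain ⟨y, rfl⟩ := hN.exists_primitive hd
  refine ⟨proj N.gr (p - 1) y, N.proj_mem _ _, ?_⟩
  rw [d_proj, sub_add_cancel, proj_same N.gr hx]

theorem cohomologyMap_mk {M N : DGMod B} (f : Hom M N) (m : M) (hm : m ∈ LinearMap.ker M.d) :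
    f.cohomologyMap (Submodule.Quotient.mk ⟨m, hm⟩) = Submodule.Quotient.mk
      ⟨f.lin m, by rw [LinearMap.mem_ker] at hm ⊢; rw [← f.lin_d, hm, map_zero]⟩ := rfl

theorem Homotopic.cohomologyMap_eq {M N : DGMod B} {f g : Hom M N} :
    Homotopic f g → f.cohomologyMap = g.cohomologyMap := by
  rintro ⟨h, hh, e⟩
  refine LinearMap.ext fun x => ?_
  obtain ⟨⟨m, hm⟩, rfl⟩ := Submodule.Quotient.mk_surjective _ x
  rw [cohomologyMap_mk, cohomologyMap_mk, Submodule.Quotient.eq]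
  refine ⟨h m, ?_⟩
  have h2 := Homotopic.apply e m
  rw [LinearMap.mem_ker.1 hm, map_zero, add_zero] at h2
  exact h2.symm

theorem cohomologyMap_comp {L M N : DGMod B} (g : Hom M N) (f : Hom L M) (x : L.Cohomology) :
    (g.comp f).cohomologyMap x = g.cohomologyMap (f.cohomologyMap x) := by
  obtain ⟨⟨m, hm⟩, rfl⟩ := Submodule.Quotient.mk_surjective _ x
  rfl

/-- If `g` and `l` are quasi-isomorphisms and `g ∘ f` is homotopic to `l`, then `f` is a
quasi-isomorphism. -/
theorem Hom.IsQuasiIso.of_comp {L M N : DGMod B} {g : Hom M N} {f : Hom L M} {l : Hom L N}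
    (hg : g.IsQuasiIso) (hl : l.IsQuasiIso) (h : Homotopic (g.comp f) l) : f.IsQuasiIso := by
  have e : ⇑l.cohomologyMap = ⇑g.cohomologyMap ∘ ⇑f.cohomologyMap := by
    rw [← h.cohomologyMap_eq]
    exact funext (cohomologyMap_comp g f)
  unfold Hom.IsQuasiIso at *
  rw [e] at hl
  exact (Function.Bijective.of_comp_iff' hg _).1 hl

theorem Hom.isQuasiIso_id (M : DGMod B) : (Hom.id M).IsQuasiIso := by
  have : ⇑(Hom.id M).cohomologyMap = _root_.id := by
    funext x
    obtain ⟨⟨m, hm⟩, rfl⟩ := Submodule.Quotient.mk_surjective _ x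
    rfl
  unfold Hom.IsQuasiIso
  rw [this]
  exact Function.bijective_id

theorem Hom.IsQuasiIso.cone_isAcyclic {L M : DGMod B} {s : Hom L M} (hs : s.IsQuasiIso) :
    (cone s).IsAcyclic := by
  refine ⟨fun x y => ?_⟩
  suffices H : ∀ z : (cone s).Cohomology, z = 0 by rw [H x, H y]
  clear x y
  intro z
  obtain ⟨⟨⟨l, m⟩, hlm⟩, rfl⟩ := Submodule.Quotient.mk_surjective _ z
  rw [Submodule.Quotient.mk_eq_zero]
  have h0 := LinearMap.mem_ker.1 hlm
  change L at l
  have hl : l ∈ LinearMap.ker L.d := by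
    have : sg k 1 • L.d l = 0 := congrArg Prod.fst h0
    rw [LinearMap.mem_ker]
    simpa [sg_one] using this
  have hm : s.lin l + M.d m = 0 := congrArg Prod.snd h0
  -- `l` is a boundary, because `s l` is one
  have h1 : (Submodule.Quotient.mk ⟨l, hl⟩ : L.Cohomology) = 0 := by
    refine hs.1 ?_
    rw [map_zero, cohomologyMap_mk, Submodule.Quotient.mk_eq_zero]
    refine ⟨-m, ?_⟩
    rw [map_neg]
    exact neg_eq_of_add_eq_zero_left hm
  rw [Submodule.Quotient.mk_eq_zero] at h1
  obtain ⟨l', hl' : L.d l' = l⟩ := h1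
  -- `s l' + m` is a cocycle, hence cohomologous to some `s l''`
  have hc : s.lin l' + m ∈ LinearMap.ker M.d := by
    rw [LinearMap.mem_ker, map_add, ← s.lin_d, hl', hm]
  obtain ⟨z, hz⟩ := hs.2 (Submodule.Quotient.mk ⟨_, hc⟩)
  obtain ⟨⟨l'', hl''⟩, rfl⟩ := Submodule.Quotient.mk_surjective _ z
  rw [cohomologyMap_mk, Submodule.Quotient.eq] at hz
  obtain ⟨m', hm' : M.d m' = s.lin l'' - (s.lin l' + m)⟩ := hz
  refine ⟨((show L from l'' - l'), -m'), Prod.ext ?_ ?_⟩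
  · change sg k 1 • L.d (l'' - l') = l
    rw [map_sub, LinearMap.mem_ker.1 hl'', hl', sg_one]
    simp
  · change s.lin (l'' - l') + M.d (-m') = m
    rw [map_sub, map_neg, hm']
    abel

/-- A morphism from a homotopically projective module lifts along a quasi-isomorphism, up to
homotopy. The lift and the homotopy are the two components of a contraction of the induced
morphism to the cone. -/
theorem IsHProj.exists_lift {P L M : DGMod B} (hP : P.IsHProj) {s : Hom L M} (hs : s.IsQuasiIso)
    (f : Hom P M) : ∃ g : Hom P L, Homotopic (s.comp g) f := by
  let ι : Hom P (cone s) :=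
    { toLin := (LinearMap.inr B (L.shift 1) M) ∘ₗ f.toLin
      map_mem := fun hm => ⟨zero_mem _, f.map_mem hm⟩
      map_d := fun m => Prod.ext (map_zero (L.shift 1).d).symm (by
        change f.lin (P.d m) = s.lin 0 + M.d (f.lin m)
        rw [map_zero, zero_add, f.lin_d]) }
  let o : Hom P (cone s) := ⟨0, fun _ => zero_mem _, fun m => (map_zero (cone s).d).symm⟩
  obtain ⟨h, hh, e⟩ := hP _ hs.cone_isAcyclic ι o
  let h1 : P →ₗ[k] L := (LinearMap.fst k (L.shift 1) M) ∘ₗ h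
  let h2 : P →ₗ[k] M := (LinearMap.snd k (L.shift 1) M) ∘ₗ h
  have e1 (m : P) : h1 (P.d m) = L.d (h1 m) := by
    have : (0 : L) - 0 = sg k 1 • L.d (h1 m) + h1 (P.d m) :=
      congrArg Prod.fst (Homotopic.apply e m)
    rw [sg_one, neg_one_smul, sub_zero] at this
    exact (neg_add_eq_zero.1 this.symm).symm
  have e2 (m : P) : f.lin m = s.lin (h1 m) + M.d (h2 m) + h2 (P.d m) := by
    have : f.lin m - 0 = (s.lin (h1 m) + M.d (h2 m)) + h2 (P.d m) :=
      congrArg Prod.snd (Homotopic.apply e m)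
    rwa [sub_zero] at this
  have hlin (b : B) (m : P) : h1 (b • m) = b • h1 m := by
    refine hom_induction B.gr b (by simp) (fun x y hx hy => by simp [add_smul, hx, hy])
      fun p b hb => ?_
    have : h1 (b • m) = sg k (-1 * p) • (twist B 1 b • h1 m) := congrArg Prod.fst (hh.2 p b hb m)
    rw [this, twist_apply 1 hb, smul_assoc, smul_smul, ← sg_add, sg_congr (n := 0) 0 (by ring),
      sg_zero, one_smul]
  refine ⟨⟨⟨⟨h1, map_add h1⟩, hlin⟩, fun {p m} hm => ?_, e1⟩, Homotopic.symm ?_⟩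
  · exact L.mem_deg (hh.1 p m hm).1 (by ring)
  · refine homotopic_of_apply (h := h2) ⟨fun p m hm => (hh.1 p m hm).2, fun p b hb m =>
      congrArg Prod.snd (hh.2 p b hb m)⟩ fun m => ?_
    change f.lin m - s.lin (h1 m) = _
    rw [e2]
    abel

end DGMod

/-! ### Finite filtered bases -/

namespace DGMod

variable {k : Type v} [Field k] {B : DGAlg.{v, u} k}

/-- A finite basis of the underlying graded `B`-module of `M` which consists of homogeneous
elements: the basis elements `e i` with their degrees, and the coordinate functions. The
differential of `M` plays no role. -/
structure HomogBasis (M : DGMod B) where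
  ι : Type
  [fintype : Fintype ι]
  [decEq : DecidableEq ι]
  deg : ι → ℤ
  e : ι → M
  coord : ι → M →ₗ[k] B
  e_mem : ∀ i, e i ∈ M.gr (deg i)
  coord_mem : ∀ i {p : ℤ} {x : M}, x ∈ M.gr p → coord i x ∈ B.gr (p - deg i)
  coord_smul : ∀ i (b : B) (x : M), coord i (b • x) = b * coord i x
  coord_e : ∀ i j, coord i (e j) = if i = j then 1 else 0
  sum_coord : ∀ x, ∑ i, coord i x • e i = x

attribute [instance] HomogBasis.fintype HomogBasis.decEq

/-- A homogeneous basis is filtered by a rank function if the differential of a basis element is a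
combination of basis elements of strictly smaller rank. -/
def HomogBasis.IsFiltered {M : DGMod B} (b : M.HomogBasis) (rank : b.ι → ℕ) : Prop :=
  ∀ i j, rank i ≤ rank j → b.coord j (M.d (b.e i)) = 0

/-- Existence of a finite homogeneous basis, filtered by a rank function. This property follows
from being finitely generated semi-free, and is easier to transport through duality. -/
def HasFilteredBasis (M : DGMod B) : Prop :=
  ∃ (b : M.HomogBasis) (rank : b.ι → ℕ), b.IsFiltered rank

theorem twist_twist (n : ℤ) (a : B) : twist B n (twist B n a) = a := by
  refine hom_induction B.gr a (by simp) (fun x y hx hy => by simp [hx, hy]) fun p a ha => ?_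
  rw [twist_apply n ha, map_smul, twist_apply n ha, smul_smul, sg_mul_self, one_smul]

theorem twist_mem {n p : ℤ} {a : B} (ha : a ∈ B.gr p) : twist B n a ∈ B.gr p := by
  rw [twist_apply n ha]
  exact Submodule.smul_mem _ _ ha

/-- A morphism of degree `n` satisfies `ψ (b m) = (-1)^{n|b|} b ψ m`, without assuming that `b`
is homogeneous. -/
theorem homGr_smul {M N : DGMod B} {n : ℤ} {ψ : M →ₗ[k] N} (hψ : ψ ∈ homGr M N n) (b : B) (m : M) :
    ψ (b • m) = twist B n b • ψ m := by
  refine hom_induction B.gr b (by simp) (fun x y hx hy => by simp [add_smul, hx, hy])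
    fun p b hb => ?_
  rw [hψ.2 p b hb, twist_apply n hb, smul_assoc]

namespace HomogBasis

/-- The homogeneous basis `1` of the free module of rank one. -/
def self (B : DGAlg.{v, u} k) : (DGMod.self B).HomogBasis where
  ι := Unit
  deg _ := 0
  e _ := (1 : B)
  coord _ := LinearMap.id
  e_mem _ := B.one_mem
  coord_mem _ {p x} hx := B.mem_deg hx (sub_zero p).symm
  coord_smul _ _ _ := rfl
  coord_e _ _ := rfl
  sum_coord x := by
    rw [Fintype.sum_unique]
    exact mul_one (show B from x)

/-- The empty basis. -/
def empty (M : DGMod B) (h : Subsingleton M) : M.HomogBasis where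
  ι := Empty
  deg := Empty.elim
  e i := i.elim
  coord i := i.elim
  e_mem i := i.elim
  coord_mem i := i.elim
  coord_smul i := i.elim
  coord_e i := i.elim
  sum_coord _ := h.elim _ _

/-- A basis of `M` as a basis of the shift `M[n]`. The coordinates are twisted, because `B` acts on
`M[n]` through the automorphism `twist B n`. -/
def shift {M : DGMod B} (b : M.HomogBasis) (n : ℤ) : (M.shift n).HomogBasis where
  ι := b.ι
  deg i := b.deg i - n
  e := b.e
  coord i := (twist B n).toLinearMap ∘ₗ b.coord i
  e_mem i := M.mem_deg (b.e_mem i) (by ring)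
  coord_mem i {p x} hx := twist_mem (B.mem_deg (b.coord_mem i hx) (by ring))
  coord_smul i a x := by
    change twist B n (b.coord i (twist B n a • (show M from x))) = a * twist B n (b.coord i x)
    rw [b.coord_smul, map_mul, twist_twist]
  coord_e i j := by
    change twist B n (b.coord i (b.e j)) = _
    rw [b.coord_e]
    split_ifs
    · exact map_one _
    · exact map_zero _
  sum_coord x := by
    change ∑ i, (twist B n (twist B n (b.coord i x)) • b.e i : M) = x
    simp only [twist_twist]
    exact b.sum_coord x

/-- The disjoint union of two bases, as a basis of the direct sum. -/
def prod {M N : DGMod B} (b : M.HomogBasis) (c : N.HomogBasis) : (M.prod N).HomogBasis where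
  ι := b.ι ⊕ c.ι
  deg := Sum.elim b.deg c.deg
  e := Sum.elim (fun i => (b.e i, (0 : N))) (fun j => ((0 : M), c.e j))
  coord := Sum.elim (fun i => b.coord i ∘ₗ LinearMap.fst k M N)
    (fun j => c.coord j ∘ₗ LinearMap.snd k M N)
  e_mem := by
    rintro (i | j)
    · exact ⟨b.e_mem i, zero_mem _⟩
    · exact ⟨zero_mem _, c.e_mem j⟩
  coord_mem := by
    rintro (i | j) p x hx
    · exact b.coord_mem i hx.1
    · exact c.coord_mem j hx.2
  coord_smul := by
    rintro (i | j) a x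
    · exact b.coord_smul i a x.1
    · exact c.coord_smul j a x.2
  coord_e := by
    rintro (i | i) (j | j)
    · simp only [Sum.inl.injEq]
      exact b.coord_e i j
    · rw [if_neg Sum.inl_ne_inr]
      exact map_zero (b.coord i)
    · rw [if_neg Sum.inr_ne_inl]
      exact map_zero (c.coord i)
    · simp only [Sum.inr.injEq]
      exact c.coord_e i j
  sum_coord := by
    rintro ⟨x, y⟩
    rw [Fintype.sum_sum_type]
    change ∑ i, b.coord i x • ((b.e i, 0) : M × N) + ∑ j, c.coord j y • ((0, c.e j) : M × N) = (x, y)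
    simp only [Prod.smul_mk, smul_zero]
    refine Prod.ext ?_ ?_
    · simp [Prod.fst_sum, b.sum_coord]
    · simp [Prod.snd_sum, c.sum_coord]

/-- The cone of `f : L → M` has the same underlying graded module as `L[1] ⊕ M`. -/
def cone {L M : DGMod B} (f : Hom L M) (b : L.HomogBasis) (c : M.HomogBasis) :
    (DGMod.cone f).HomogBasis :=
  let a := (b.shift 1).prod c
  { ι := a.ι
    deg := a.deg
    e := a.e
    coord := a.coord
    e_mem := a.e_mem
    coord_mem := a.coord_mem
    coord_smul := a.coord_smul
    coord_e := a.coord_e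
    sum_coord := a.sum_coord }

/-- Transport of a basis along an isomorphism. -/
def ofIso {M N : DGMod B} (b : M.HomogBasis) (f : Hom M N) (g : Hom N M)
    (hgf : g.comp f = Hom.id M) (hfg : f.comp g = Hom.id N) : N.HomogBasis where
  ι := b.ι
  deg := b.deg
  e i := f.lin (b.e i)
  coord i := b.coord i ∘ₗ g.lin
  e_mem i := f.map_mem (b.e_mem i)
  coord_mem i {p x} hx := b.coord_mem i (g.map_mem hx)
  coord_smul i a x := by
    rw [LinearMap.comp_apply, g.lin_smul, b.coord_smul]
    rfl
  coord_e i j := by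
    have : g.lin (f.lin (b.e j)) = b.e j := congrArg (fun h : Hom M M => h.lin (b.e j)) hgf
    rw [LinearMap.comp_apply, this, b.coord_e]
  sum_coord x := by
    have : f.lin (g.lin x) = x := congrArg (fun h : Hom N N => h.lin x) hfg
    simp only [LinearMap.comp_apply, ← f.lin_smul, ← map_sum, b.sum_coord, this]

variable {M N : DGMod B} (b : M.HomogBasis)

/-- Morphisms of degree `n` are determined by their values on a basis. -/
theorem hom_ext {n : ℤ} {φ ψ : M →ₗ[k] N} (hφ : φ ∈ homGr M N n) (hψ : ψ ∈ homGr M N n)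
    (h : ∀ i, φ (b.e i) = ψ (b.e i)) : φ = ψ := by
  ext x
  rw [← b.sum_coord x, map_sum, map_sum]
  exact Finset.sum_congr rfl fun i _ => by rw [homGr_smul hφ, homGr_smul hψ, h]

/-- The morphism of degree `n` with the values `y i` on the basis elements `e i`. -/
def lift (n : ℤ) (y : b.ι → N) : M →ₗ[k] N :=
  ∑ i, ((Algebra.lsmul k k N).toLinearMap.flip (y i)) ∘ₗ (twist B n).toLinearMap ∘ₗ b.coord i

theorem lift_apply (n : ℤ) (y : b.ι → N) (x : M) :
    b.lift n y x = ∑ i, twist B n (b.coord i x) • y i := by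
  simp [lift]

theorem lift_e (n : ℤ) (y : b.ι → N) (j : b.ι) : b.lift n y (b.e j) = y j := by
  rw [lift_apply, Finset.sum_eq_single j]
  · rw [b.coord_e, if_pos rfl, map_one, one_smul]
  · intro i _ hij
    rw [b.coord_e, if_neg hij, map_zero, zero_smul]
  · exact fun h => absurd (Finset.mem_univ j) h

theorem lift_mem {n : ℤ} {y : b.ι → N} (hy : ∀ i, y i ∈ N.gr (b.deg i + n)) :
    b.lift n y ∈ homGr M N n := by
  refine ⟨fun p m hm => ?_, fun p a ha m => ?_⟩
  · rw [lift_apply]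
    refine sum_mem fun i _ => N.mem_deg (N.smul_mem (twist_mem (b.coord_mem i hm)) (hy i)) ?_
    ring
  · rw [lift_apply, lift_apply, Finset.smul_sum, Finset.smul_sum]
    refine Finset.sum_congr rfl fun i _ => ?_
    rw [b.coord_smul, map_mul, twist_apply n ha, smul_mul_assoc, smul_assoc, mul_smul]

variable {b}

theorem IsFiltered.prod {b : M.HomogBasis} {c : N.HomogBasis} {r : b.ι → ℕ} {s : c.ι → ℕ}
    (hb : b.IsFiltered r) (hc : c.IsFiltered s) :
    (b.prod c).IsFiltered (Sum.elim r s) := by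
  rintro (i | i) (j | j) hij
  · exact hb i j hij
  · change c.coord j (N.d 0) = 0
    simp
  · change b.coord j (M.d 0) = 0
    simp
  · exact hc i j hij

theorem IsFiltered.shift {r : b.ι → ℕ} (hb : b.IsFiltered r) (n : ℤ) :
    (b.shift n).IsFiltered r := fun i j hij => by
  change twist B n (b.coord j (sg k n • M.d (b.e i))) = 0
  rw [map_smul, hb i j hij, smul_zero, map_zero]

/-- In the cone of `f : L → M`, the basis elements of `L[1]` get a larger rank than those of
`M`. -/
theorem IsFiltered.cone {L : DGMod B} (f : Hom L M) {c : L.HomogBasis} {r : b.ι → ℕ}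
    {s : c.ι → ℕ} (hb : b.IsFiltered r) (hc : c.IsFiltered s) :
    (HomogBasis.cone f c b).IsFiltered
      (Sum.elim (fun i => s i + (Finset.univ.sup r + 1)) r) := by
  rintro (i | i) (j | j) hij
  · exact hc.shift 1 i j (Nat.le_of_add_le_add_right hij)
  · have h1 : s i + (Finset.univ.sup r + 1) ≤ r j := hij
    have h2 : r j ≤ Finset.univ.sup r := Finset.le_sup (Finset.mem_univ j)
    omega
  · change twist B 1 (c.coord j (sg k 1 • L.d 0)) = 0
    simp
  · change b.coord j (f.lin 0 + M.d (b.e i)) = 0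
    rw [map_zero, zero_add]
    exact hb i j hij

end HomogBasis

theorem HasFilteredBasis.of_iso {M N : DGMod B} (h : Iso M N) :
    M.HasFilteredBasis → N.HasFilteredBasis := by
  rintro ⟨b, r, hb⟩
  obtain ⟨f, g, hgf, hfg⟩ := h
  refine ⟨b.ofIso f g hgf hfg, r, fun i j hij => ?_⟩
  change b.coord j (g.lin (N.d (f.lin (b.e i)))) = 0
  have : g.lin (f.lin (M.d (b.e i))) = M.d (b.e i) :=
    congrArg (fun h : Hom M M => h.lin (M.d (b.e i))) hgf
  rw [← f.lin_d, this]
  exact hb i j hij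

theorem IsFGFree.hasFilteredBasis {M : DGMod B} (h : IsFGFree M) : M.HasFilteredBasis := by
  induction h with
  | zero M h => exact ⟨HomogBasis.empty M h, Empty.elim, fun i => i.elim⟩
  | shift n =>
    have h : (HomogBasis.self B).IsFiltered fun _ => 0 := fun _ _ _ => B.d_one
    exact ⟨_, _, h.shift n⟩
  | prod _ _ hM hN =>
    obtain ⟨b, r, hb⟩ := hM
    obtain ⟨c, s, hc⟩ := hN
    exact ⟨_, _, hb.prod hc⟩
  | iso e _ h => exact h.of_iso e

theorem IsFGSemiFree.hasFilteredBasis {M : DGMod B} (h : IsFGSemiFree M) :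
    M.HasFilteredBasis := by
  induction h with
  | free h => exact h.hasFilteredBasis
  | cone f _ _ hL hM =>
    obtain ⟨b, r, hb⟩ := hM
    obtain ⟨c, s, hc⟩ := hL
    exact ⟨_, _, hb.cone f hc⟩
  | iso e _ h => exact h.of_iso e

/-- A module with a finite filtered basis is homotopically projective: a homotopy is constructed
on the basis elements, by induction on their rank. -/
theorem HasFilteredBasis.isHProj {M : DGMod B} (h : M.HasFilteredBasis) : M.IsHProj := by
  obtain ⟨b, r, hb⟩ := h
  intro N hN f g
  -- a homogeneous morphism that kills the basis elements of rank less than `n` kills the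
  -- differentials of the elements of rank at most `n`
  have key (ψ : M →ₗ[k] N) (m : ℤ) (hψ : ψ ∈ homGr M N m) (n : ℕ)
      (h0 : ∀ i, r i < n → ψ (b.e i) = 0) (i : b.ι) (hi : r i ≤ n) : ψ (M.d (b.e i)) = 0 := by
    rw [← b.sum_coord (M.d (b.e i)), map_sum]
    refine Finset.sum_eq_zero fun j _ => ?_
    by_cases hj : r j < n
    · rw [homGr_smul hψ, h0 j hj, smul_zero]
    · rw [hb i j (by omega), zero_smul, map_zero]
  have step (n : ℕ) : ∃ h ∈ homGr M N (-1), ∀ i, r i < n →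
      (f.lin - g.lin) (b.e i) = homD M N (-1) h (b.e i) := by
    -- the defect `ψ` maps a basis element of rank `n` to a cocycle, because it vanishes in smaller
    -- ranks; the primitives of these cocycles are the values of the correction `c`
    induction n with
    | zero => exact ⟨0, zero_mem _, fun i hi => absurd hi (Nat.not_lt_zero _)⟩
    | succ n ih =>
      obtain ⟨h, hh, hn⟩ := ih
      have hdh := homD_mem hh
      rw [neg_add_cancel] at hdh
      let ψ := f.lin - g.lin - homD M N (-1) h
      have hψ : ψ ∈ homGr M N 0 := sub_mem (sub_mem f.lin_mem g.lin_mem) hdh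
      have hdψ (x : M) : N.d (ψ x) = ψ (M.d x) := by
        have : homD M N 0 ψ = 0 := by
          have hd := homD_homD (M := M) (N := N) (-1) h
          rw [neg_add_cancel] at hd
          rw [map_sub, map_sub, f.homD_lin, g.homD_lin, hd, sub_zero, sub_zero]
        have := LinearMap.congr_fun this x
        rw [homD_apply, sg_zero, one_smul] at this
        exact sub_eq_zero.1 this
      have h0 (i : b.ι) (hi : r i < n) : ψ (b.e i) = 0 := sub_eq_zero.2 (hn i hi)
      have hy (i : b.ι) : ∃ y ∈ N.gr (b.deg i + -1), (r i = n → N.d y = ψ (b.e i)) ∧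
          (r i ≠ n → y = 0) := by
        by_cases hi : r i = n
        · have h1 : ψ (b.e i) ∈ N.gr (b.deg i) :=
            N.mem_deg (hψ.1 _ _ (b.e_mem i)) (add_zero _)
          have h2 : N.d (ψ (b.e i)) = 0 := by rw [hdψ, key ψ 0 hψ n h0 i hi.le]
          obtain ⟨y, hy, hdy⟩ := hN.exists_homogeneous_primitive h1 h2
          exact ⟨y, hy, fun _ => hdy, fun h => absurd hi h⟩
        · exact ⟨0, zero_mem _, fun h => absurd h hi, fun _ => rfl⟩
      choose y hy hy1 hy0 using hy
      -- `c` corrects `h` on the basis elements of rank `n` and vanishes on the other ones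
      let c : M →ₗ[k] N := b.lift (-1) y
      have hc : c ∈ homGr M N (-1) := b.lift_mem hy
      have hc0 (i : b.ι) (hi : r i < n) : c (b.e i) = 0 := by
        rw [b.lift_e, hy0 i hi.ne]
      refine ⟨h + c, add_mem hh hc, fun i hi => ?_⟩
      have e1 : homD M N (-1) c (b.e i) = ψ (b.e i) := by
        rw [homD_apply, key c (-1) hc n hc0 i (by omega), smul_zero, sub_zero, b.lift_e]
        by_cases hi' : r i = n
        · exact hy1 i hi'
        · rw [hy0 i hi', map_zero, h0 i (by omega)]
      rw [map_add, LinearMap.add_apply, e1]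
      exact (add_sub_cancel _ _).symm
  obtain ⟨h, hh, e⟩ := step (Finset.univ.sup r + 1)
  have hdh := homD_mem hh
  rw [neg_add_cancel] at hdh
  refine ⟨h, hh, b.hom_ext (n := 0) (sub_mem f.lin_mem g.lin_mem) hdh fun i => ?_⟩
  exact e i (Nat.lt_succ_of_le (Finset.le_sup (Finset.mem_univ i)))

end DGMod

/-! ### Duality and evaluation for modules with a finite basis -/

namespace DGMod

variable {k : Type v} [Field k] {B : DGAlg.{v, u} k}

/-- The evaluation of the elements of the dual of `M` at `m`. -/
def dualEval (M : DGMod B.op) (m : M) : dual M →ₗ[k] B where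
  toFun f := B.toOp.symm ((show dualSpace M from f).1 m)
  map_add' _ _ := rfl
  map_smul' _ _ := rfl

theorem dualEval_smul (M : DGMod B.op) (m : M) (b : B) (f : dual M) :
    dualEval M m (b • f) = b * dualEval M m f := rfl

theorem dual_ext {M : DGMod B.op} {f g : dual M} (h : ∀ m, dualEval M m f = dualEval M m g) :
    f = g :=
  Subtype.ext (LinearMap.ext h)

/-- The differential of the dual, evaluated at an element. -/
theorem dualEval_d (M : DGMod B.op) {n : ℤ} {f : dual M} (hf : f ∈ (dual M).gr n) (m : M) :
    dualEval M m ((dual M).d f) = B.d (dualEval M m f) - sg k n • dualEval M (M.d m) f := by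
  change B.toOp.symm (dualD M f m) = _
  rw [dualD_apply M (n := n) (f := f) hf]
  rfl

namespace HomogBasis

variable {M : DGMod B.op} (b : M.HomogBasis)

/-- The linear form on `M` with the value `1` at `e i` which vanishes on the other basis
elements, as a morphism of degree `-deg i`. -/
def dualVec (i : b.ι) : M →ₗ[k] DGMod.self B.op :=
  b.lift (N := DGMod.self B.op) (-b.deg i) fun j => (if i = j then 1 else 0 : B.op)

theorem dualVec_mem (i : b.ι) : b.dualVec i ∈ homGr M (DGMod.self B.op) (-b.deg i) := by
  refine b.lift_mem (N := DGMod.self B.op) fun j => ?_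
  change (if i = j then 1 else 0 : B.op) ∈ B.op.gr _
  split_ifs with h
  · subst h
    rw [add_neg_cancel]
    exact B.op.one_mem
  · exact zero_mem _

theorem dualVec_e (i j : b.ι) : b.dualVec i (b.e j) = (if i = j then 1 else 0 : B.op) :=
  b.lift_e (N := DGMod.self B.op) _ _ j

/-- `dualVec` as an element of the dual module. -/
def dualElt (i : b.ι) : DGMod.dual M :=
  (⟨b.dualVec i, homGr_le M _ (b.dualVec_mem i)⟩ : dualSpace M)

theorem dualElt_mem (i : b.ι) : b.dualElt i ∈ (DGMod.dual M).gr (-b.deg i) := b.dualVec_mem i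

theorem dualEval_dualElt (i j : b.ι) :
    dualEval M (b.e j) (b.dualElt i) = if j = i then 1 else 0 := by
  refine (b.dualVec_e i j).trans ?_
  simp only [eq_comm (a := j)]
  rfl

theorem sum_dualElt {n : ℤ} {f : DGMod.dual M} (hf : f ∈ (DGMod.dual M).gr n) :
    ∑ i, dualEval M (b.e i) f • b.dualElt i = f := by
  have he (i : b.ι) : dualEval M (b.e i) f ∈ B.gr (b.deg i + n) := hf.1 _ _ (b.e_mem i)
  have hs : ∑ i, dualEval M (b.e i) f • b.dualElt i ∈ (DGMod.dual M).gr n :=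
    sum_mem fun i _ => (DGMod.dual M).mem_deg
      ((DGMod.dual M).smul_mem (he i) (b.dualElt_mem i)) (by ring)
  refine Subtype.ext (b.hom_ext (n := n) hs hf fun j => ?_)
  change dualEval M (b.e j) _ = dualEval M (b.e j) f
  rw [map_sum, Finset.sum_eq_single j]
  · rw [dualEval_smul, dualEval_dualElt, if_pos rfl, mul_one]
  · intro i _ hij
    rw [dualEval_smul, dualEval_dualElt, if_neg hij.symm, mul_zero]
  · exact fun h => absurd (Finset.mem_univ j) h

/-- The dual basis of `Hom(M, B)`. The coordinate of `f` at `i` is `f (e i)`. -/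
def dual : (DGMod.dual M).HomogBasis where
  ι := b.ι
  deg i := -b.deg i
  e := b.dualElt
  coord i := dualEval M (b.e i)
  e_mem := b.dualElt_mem
  coord_mem i {p f} hf := B.mem_deg (hf.1 _ _ (b.e_mem i)) (by ring)
  coord_smul i a f := rfl
  coord_e i j := b.dualEval_dualElt j i
  sum_coord f := by
    refine hom_induction (DGMod.dual M).gr f ?_ (fun x y hx hy => ?_)
      fun n f hf => b.sum_dualElt hf
    · simp only [map_zero, zero_smul, Finset.sum_const_zero]
    · simp only [map_add, add_smul, Finset.sum_add_distrib, hx, hy]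

variable {b}

/-- The dual basis is filtered by the opposite ranks. -/
theorem IsFiltered.dual {r : b.ι → ℕ} (hb : b.IsFiltered r) :
    b.dual.IsFiltered fun i => Finset.univ.sup r - r i := by
  intro (i : b.ι) (j : b.ι) (hij : Finset.univ.sup r - r i ≤ Finset.univ.sup r - r j)
  have hj : r j ≤ Finset.univ.sup r := Finset.le_sup (Finset.mem_univ j)
  have hi : r i ≤ Finset.univ.sup r := Finset.le_sup (Finset.mem_univ i)
  refine (dualEval_d M (b.dualVec_mem i) (b.e j)).trans ?_
  have h1 : B.d (dualEval M (b.e j) (b.dualElt i)) = 0 := by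
    rw [dualEval_dualElt]
    split_ifs
    · exact B.d_one
    · exact map_zero _
  have h2 : dualEval M (M.d (b.e j)) (b.dualElt i) = 0 := by
    refine (b.lift_apply (N := DGMod.self B.op) _ _ _).trans (Finset.sum_eq_zero fun l _ => ?_)
    by_cases h : i = l
    · subst h
      rw [hb j i (by omega), map_zero]
      exact zero_smul B.op _
    · rw [if_neg h]
      exact mul_zero (M₀ := B.op) _
  change B.d (dualEval M (b.e j) (b.dualElt i)) -
    sg k (-b.deg i) • dualEval M (M.d (b.e j)) (b.dualElt i) = 0
  rw [h1, h2, smul_zero, sub_zero]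

end HomogBasis

theorem HasFilteredBasis.dual {M : DGMod B.op} (h : M.HasFilteredBasis) :
    (dual M).HasFilteredBasis := by
  obtain ⟨b, r, hb⟩ := h
  exact ⟨b.dual, _, hb.dual⟩

theorem tmk_smul_left {M : DGMod B.op} {N : DGMod B} {p q : ℤ} {b : B} (hb : b ∈ B.gr p) {m : M}
    (hm : m ∈ M.gr q) (n : N) : tmk (B.toOp b • m) n = sg k (p * q) • tmk m (b • n) := by
  have h : sg k (p * q) • (tmk (B.toOp b • m) n : Tensor M N) = tmk m (b • n) :=
    (Submodule.Quotient.eq _).2 (mem_tensorRel hb hm n)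
  rw [← h, smul_smul, sg_mul_self, one_smul]

theorem tmk_add_left {M : DGMod B.op} {N : DGMod B} (m m' : M) (n : N) :
    tmk (m + m') n = tmk m n + tmk m' n := by
  simp [tmk, TensorProduct.add_tmul]

theorem tmk_add_right {M : DGMod B.op} {N : DGMod B} (m : M) (n n' : N) :
    tmk m (n + n') = tmk m n + tmk m n' := by
  simp [tmk, TensorProduct.tmul_add]

theorem tmk_smul_right {M : DGMod B.op} {N : DGMod B} (r : k) (m : M) (n : N) :
    tmk m (r • n) = r • tmk m n := by
  simp [tmk]

theorem tmk_sum_left {M : DGMod B.op} {N : DGMod B} {ι : Type*} (s : Finset ι) (m : ι → M)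
    (n : N) : tmk (∑ i ∈ s, m i) n = ∑ i ∈ s, tmk (m i) n := by
  simp [tmk, TensorProduct.sum_tmul]

/-- If `M` has a basis `e`, every element of `M ⊗ N` has the form `∑ e i ⊗ y i`. -/
theorem HomogBasis.exists_eq_sum_tmk {M : DGMod B.op} (b : M.HomogBasis) {N : DGMod B} {n : ℤ}
    {x : Tensor M N} (hx : x ∈ tensorGr M N n) :
    ∃ y : b.ι → N, (∀ i, y i ∈ N.gr (n - b.deg i)) ∧ x = ∑ i, tmk (b.e i) (y i) := by
  refine tensorGr_induction hx ⟨0, fun _ => zero_mem _, ?_⟩ ?_ ?_ ?_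
  · simp [tmk_zero_right]
  · rintro _ _ ⟨y, hy, rfl⟩ ⟨z, hz, rfl⟩
    refine ⟨y + z, fun i => add_mem (hy i) (hz i), ?_⟩
    simp [tmk_add_right, Finset.sum_add_distrib]
  · rintro r _ ⟨y, hy, rfl⟩
    refine ⟨r • y, fun i => Submodule.smul_mem _ r (hy i), ?_⟩
    simp [tmk_smul_right, Finset.smul_sum]
  · intro p q h m hm z hz
    have hc (i : b.ι) : B.toOp.symm (b.coord i m) ∈ B.gr (p - b.deg i) := b.coord_mem i hm
    refine ⟨fun i => sg k ((p - b.deg i) * b.deg i) • (B.toOp.symm (b.coord i m) • z),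
      fun i => Submodule.smul_mem _ _ (N.mem_deg (N.smul_mem (hc i) hz) (by omega)), ?_⟩
    conv_lhs => rw [← b.sum_coord m]
    rw [tmk_sum_left]
    refine Finset.sum_congr rfl fun i _ => ?_
    rw [tmk_smul_right, ← tmk_smul_left (hc i) (b.e_mem i)]
    rfl

theorem evalAt_id (M : DGMod B.op) (f : dual M) (m : M) :
    evalAt (Hom.id (dual M)) f m = dualEval M m f := rfl

theorem HomogBasis.eval_sum {M : DGMod B.op} (b : M.HomogBasis) {N : DGMod B} {n : ℤ}
    {y : b.ι → N} (hy : ∀ i, y i ∈ N.gr (n - b.deg i)) (j : b.ι) :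
    eval (Hom.id (DGMod.dual M)) N (∑ i, tmk (b.e i) (y i)) (b.dual.e j) =
      sg k (b.deg j * n) • y j := by
  rw [map_sum, LinearMap.sum_apply, Finset.sum_eq_single j]
  · rw [eval_tmk _ N (b.e_mem j) (hy j) (b.dual.e_mem j), evalAt_id]
    have : dualEval M (b.e j) (b.dual.e j) = 1 := (b.dualEval_dualElt j j).trans (if_pos rfl)
    rw [this, one_smul]
    congr 1
    change sg k (-b.deg j * _) = _
    exact sg_congr (-(b.deg j * n)) (by ring)
  · intro i _ hij
    rw [eval_tmk _ N (b.e_mem i) (hy i) (b.dual.e_mem j), evalAt_id]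
    have : dualEval M (b.e i) (b.dual.e j) = 0 := (b.dualEval_dualElt j i).trans (if_neg hij)
    rw [this, zero_smul, smul_zero]
  · exact fun h => absurd (Finset.mem_univ j) h

/-- If `M` has a finite basis, the evaluation `M ⊗ N → Hom(Hom(M, B), N)` is bijective: both sides
are described by one element of `N` for each basis element. -/
theorem HomogBasis.eval_bijective {M : DGMod B.op} (b : M.HomogBasis) (N : DGMod B) (n : ℤ) :
    Function.Bijective ((eval (Hom.id (DGMod.dual M)) N).restrict
      (p := tensorGr M N n) (q := homGr (DGMod.dual M) N n)
      fun _ hx => eval_mem (Hom.id (DGMod.dual M)) N hx) := by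
  refine ⟨(injective_iff_map_eq_zero _).2 ?_, ?_⟩
  · rintro ⟨x, hx⟩ h
    have h : eval (Hom.id (DGMod.dual M)) N x = 0 := congrArg Subtype.val h
    obtain ⟨y, hy, rfl⟩ := b.exists_eq_sum_tmk hx
    refine Subtype.ext (Finset.sum_eq_zero fun j _ => ?_)
    have h1 := b.eval_sum hy j
    rw [h, LinearMap.zero_apply] at h1
    have h2 : y j = sg k (b.deg j * n) • (sg k (b.deg j * n) • y j) := by
      rw [smul_smul, sg_mul_self, one_smul]
    rw [h2, ← h1, smul_zero, tmk_zero_right]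
  · rintro ⟨ψ, hψ⟩
    have hy (i : b.ι) : sg k (b.deg i * n) • ψ (b.dual.e i) ∈ N.gr (n - b.deg i) := by
      refine Submodule.smul_mem _ _ (N.mem_deg (hψ.1 _ _ (b.dual.e_mem i)) ?_)
      change -b.deg i + n = _
      ring
    have hx : ∑ i, tmk (b.e i) (sg k (b.deg i * n) • ψ (b.dual.e i)) ∈ tensorGr M N n :=
      sum_mem fun i _ => tmk_mem (by ring) (b.e_mem i) (hy i)
    refine ⟨⟨_, hx⟩, Subtype.ext (b.dual.hom_ext (n := n) (eval_mem _ N hx) hψ fun j => ?_)⟩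
    refine (b.eval_sum hy j).trans ?_
    rw [smul_smul, sg_mul_self, one_smul]

/-- If `M` has a finite basis, the evaluation morphism is an isomorphism of complexes. -/
theorem HomogBasis.isIso_evalComplex {M : DGMod B.op} (b : M.HomogBasis) (N : DGMod B) :
    IsIso (evalComplex (Hom.id (DGMod.dual M)) N) := by
  have (n : ℤ) : IsIso ((evalComplex (Hom.id (DGMod.dual M)) N).f n) :=
    (ConcreteCategory.isIso_iff_bijective _).2 (b.eval_bijective N n)
  exact HomologicalComplex.Hom.isIso_of_components _

end DGMod

/-! ### Homotopy invariance of the functors -/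

namespace DGMod

variable {k : Type v} [Field k] {B : DGAlg.{v, u} k}

/-- Morphisms of complexes that differ by `dh + hd` for a family `h` of degree `-1` are equal in
the derived category. -/
theorem derivedCategory_map_eq [HasDerivedCategory.{w} (ModuleCat.{u} k)]
    {C D : CochainComplex (ModuleCat.{u} k) ℤ} {f g : C ⟶ D}
    (h : ∀ i j : ℤ, (ComplexShape.up ℤ).Rel j i → (C.X i ⟶ D.X j))
    (e : ∀ n : ℤ, f.f (n + 1) - g.f (n + 1) =
      C.d (n + 1) (n + 1 + 1) ≫ h (n + 1 + 1) (n + 1) (by simp) +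
        h (n + 1) n (by simp) ≫ D.d n (n + 1)) :
    DerivedCategory.Q.map f = DerivedCategory.Q.map g := by
  have e' : f - g = Homotopy.nullHomotopicMap' h := by
    ext1 m
    obtain ⟨n, rfl⟩ : ∃ n, m = n + 1 := ⟨m - 1, by ring⟩
    rw [Homotopy.nullHomotopicMap'_f (k₂ := n) (k₁ := n + 1) (k₀ := n + 1 + 1)
      (by simp) (by simp)]
    exact e n
  have H : Homotopy f g := (Homotopy.equivSubZero).symm
    ((Homotopy.ofEq e').trans (Homotopy.nullHomotopy' h))
  have h1 : (HomotopyCategory.quotient (ModuleCat.{u} k) (ComplexShape.up ℤ)).map f =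
      (HomotopyCategory.quotient _ _).map g := HomotopyCategory.eq_of_homotopy _ _ H
  have h2 := (DerivedCategory.quotientCompQhIso (ModuleCat.{u} k)).hom.naturality f
  have h3 := (DerivedCategory.quotientCompQhIso (ModuleCat.{u} k)).hom.naturality g
  rw [Functor.comp_map, h1, ← Functor.comp_map, h3] at h2
  exact ((cancel_epi _).1 h2).symm

theorem homGr_comp_hom {L M N : DGMod B} {m n p : ℤ} {h : L →ₗ[k] M} (hh : h ∈ homGr L M m)
    {φ : M →ₗ[k] N} (hφ : φ ∈ homGr M N n) (e : m + n = p) : φ ∘ₗ h ∈ homGr L N p := by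
  subst e
  refine ⟨fun q x hx => N.mem_deg (hφ.1 _ _ (hh.1 q x hx)) (by ring), fun q a ha x => ?_⟩
  rw [LinearMap.comp_apply, hh.2 q a ha, map_smul, hφ.2 q a ha, smul_smul, ← sg_add, ← add_mul]
  rfl

/-- `Hom(-, N)` sends homotopic morphisms to morphisms which are equal in the derived category. -/
theorem Homotopic.map_homComplexMap [HasDerivedCategory.{w} (ModuleCat.{u} k)] {L M : DGMod B}
    {f g : Hom L M} (H : Homotopic f g) (N : DGMod B) :
    DerivedCategory.Q.map (homComplexMap f N) = DerivedCategory.Q.map (homComplexMap g N) := by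
  obtain ⟨h, hh, e⟩ := H
  -- the homotopy is `φ ↦ (-1)^{|φ|} φ ∘ h`
  refine derivedCategory_map_eq (fun i j hij => ModuleCat.ofHom
    ((sg k i • LinearMap.lcomp k N h).restrict (p := homGr M N i) (q := homGr L N j)
      fun φ hφ => Submodule.smul_mem _ _ (homGr_comp_hom hh hφ (by
        rw [ComplexShape.up_Rel] at hij; omega)))) fun n => ?_
  rw [homComplex_d, homComplex_d]
  refine ModuleCat.hom_ext <| LinearMap.ext fun φ => Subtype.ext <| LinearMap.ext fun x => ?_
  change φ.1 (f.lin x) - φ.1 (g.lin x) =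
    sg k (n + 1 + 1) • (N.d (φ.1 (h x)) - sg k (n + 1) • φ.1 (M.d (h x))) +
      (N.d (sg k (n + 1) • φ.1 (h x)) - sg k n • (sg k (n + 1) • φ.1 (h (L.d x))))
  rw [← map_sub, Homotopic.apply e, map_add, map_smul]
  have e1 : sg k (n + 1) * sg k (n + 1) = 1 := sg_mul_self _
  simp only [smul_sub, smul_smul, sg_succ] at e1 ⊢
  simp only [neg_neg, mul_neg, neg_mul] at e1 ⊢
  simp only [e1, neg_smul, one_smul, sub_neg_eq_add]
  abel

/-- The map `m ⊗ n ↦ h m ⊗ n` for a morphism `h` of degree `-1`. -/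
def tensorHomotopy {M M' : DGMod B.op} {h : M →ₗ[k] M'} (hh : h ∈ homGr M M' (-1)) (N : DGMod B) :
    Tensor M N →ₗ[k] Tensor M' N :=
  (tensorRel M N).mapQ (tensorRel M' N) (TensorProduct.map h LinearMap.id) (by
    refine Submodule.span_le.2 ?_
    rintro _ ⟨p, q, b, hb, m, hm, n, rfl⟩
    have h' := mem_tensorRel (N := N) hb (hh.1 q m hm) n
    rw [SetLike.mem_coe, Submodule.mem_comap, map_sub, TensorProduct.map_tmul,
      TensorProduct.map_tmul, map_smul, hh.2 p (B.toOp b) hb, ← TensorProduct.smul_tmul',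
      ← TensorProduct.smul_tmul', smul_smul, ← sg_add]
    rw [sg_congr (n := p * q + -1 * p) 0 (by ring)] at h'
    exact h')

theorem tensorHomotopy_tmk {M M' : DGMod B.op} {h : M →ₗ[k] M'} (hh : h ∈ homGr M M' (-1))
    {N : DGMod B} (m : M) (n : N) : tensorHomotopy hh N (tmk m n) = tmk (h m) n := rfl

theorem tensorHomotopy_mem {M M' : DGMod B.op} {h : M →ₗ[k] M'} (hh : h ∈ homGr M M' (-1))
    {N : DGMod B} {i j : ℤ} (hij : j + 1 = i) {x : Tensor M N} (hx : x ∈ tensorGr M N i) :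
    tensorHomotopy hh N x ∈ tensorGr M' N j := by
  refine tensorGr_induction hx (by rw [map_zero]; exact zero_mem _)
    (fun x y hx hy => by rw [map_add]; exact add_mem hx hy)
    (fun r x hx => by rw [map_smul]; exact Submodule.smul_mem _ r hx)
    fun p q h a ha b hb => ?_
  rw [tensorHomotopy_tmk]
  exact tmk_mem (by omega) (hh.1 p a ha) hb

theorem tmk_sub_left {M : DGMod B.op} {N : DGMod B} (m m' : M) (n : N) :
    tmk (m - m') n = tmk m n - tmk m' n := by
  simp [tmk, TensorProduct.sub_tmul]

/-- `- ⊗ N` sends homotopic morphisms to morphisms which are equal in the derived category. -/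
theorem Homotopic.map_tensorComplexMap [HasDerivedCategory.{w} (ModuleCat.{u} k)]
    {M M' : DGMod B.op} {f g : Hom M M'} (H : Homotopic f g) (N : DGMod B) :
    DerivedCategory.Q.map (tensorComplexMap f N) =
      DerivedCategory.Q.map (tensorComplexMap g N) := by
  obtain ⟨h, hh, e⟩ := H
  refine derivedCategory_map_eq (fun i j hij => ModuleCat.ofHom
    ((tensorHomotopy hh N).restrict (p := tensorGr M N i) (q := tensorGr M' N j)
      fun x hx => tensorHomotopy_mem hh (by rwa [ComplexShape.up_Rel] at hij) hx)) fun n => ?_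
  rw [tensorComplex_d, tensorComplex_d]
  refine ModuleCat.hom_ext <| LinearMap.ext fun x => Subtype.ext ?_
  change tensorMap f N x.1 - tensorMap g N x.1 = tensorHomotopy hh N (tensorD M N x.1) +
    tensorD M' N (tensorHomotopy hh N x.1)
  refine tensorGr_induction x.2 (by simp) (fun x y hx hy => ?_) (fun r x hx => ?_)
    fun p q _ a ha b hb => ?_
  · simp only [map_add, add_sub_add_comm, hx, hy]
    abel
  · simp only [map_smul, ← smul_sub, hx, smul_add]
  · have ha' : h a ∈ M'.gr (p + -1) := hh.1 p a ha
    rw [tensorMap_tmk, tensorMap_tmk, ← tmk_sub_left, Homotopic.apply e, tensorD_tmk ha, map_add,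
      map_smul, tensorHomotopy_tmk, tensorHomotopy_tmk, tensorHomotopy_tmk, tensorD_tmk ha',
      tmk_add_left, sg_add, sg_congr (m := -1) (n := 1) (-1) (by ring), sg_one]
    simp only [mul_neg, mul_one, neg_smul]
    abel

/-- Duality preserves homotopies: `φ ↦ (-1)^{|φ|} φ ∘ h` is a homotopy between the duals. -/
theorem Homotopic.dualHom {M M' : DGMod B.op} {f g : Hom M M'} (H : Homotopic f g) :
    Homotopic (dualHom f) (dualHom g) := by
  obtain ⟨h, hh, e⟩ := H
  have hmem (φ : dualSpace M') : φ.1 ∘ₗ h ∈ dualSpace M := by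
    refine hom_induction (C := fun φ : dual M' => (show dualSpace M' from φ).1 ∘ₗ h ∈ dualSpace M)
      (dual M').gr φ (zero_mem _) (fun x y hx hy => add_mem hx hy) fun n φ hφ => ?_
    exact homGr_le M _ (homGr_comp_hom hh hφ rfl)
  let T : dual M' →ₗ[k] dual M :=
    { toFun := fun φ => (⟨(show dualSpace M' from φ).1 ∘ₗ h, hmem φ⟩ : dualSpace M)
      map_add' := fun _ _ => rfl
      map_smul' := fun _ _ => rfl }
  have hT (m : M) (φ : dual M') : dualEval M m (T φ) = dualEval M' (h m) φ := rfl
  have hTs {n : ℤ} {φ : dual M'} (hφ : φ ∈ (dual M').gr n) :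
      (T ∘ₗ sgnMap (dual M').gr 1) φ = sg k n • T φ := by
    rw [LinearMap.comp_apply, sgnMap_apply _ _ hφ, map_smul, one_mul]
  refine homotopic_of_apply (h := T ∘ₗ sgnMap (dual M').gr 1)
    ⟨fun n φ hφ => ?_, fun p a ha φ => ?_⟩ fun φ => ?_
  · rw [hTs hφ]
    exact Submodule.smul_mem _ _ (homGr_comp_hom hh hφ (add_comm _ _))
  · refine hom_induction (dual M').gr φ (by simp)
      (fun x y hx hy => by simp only [map_add, smul_add, hx, hy]) fun n φ hφ => ?_
    rw [hTs hφ, hTs ((dual M').smul_mem ha hφ), smul_comm a, smul_smul, ← sg_add,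
      sg_congr (m := p + n) (n := -1 * p + n) p (by ring)]
    rfl
  · refine hom_induction (dual M').gr φ (by simp) (fun x y hx hy => ?_) fun n φ hφ => ?_
    · simp only [map_add, add_sub_add_comm, hx, hy]
      abel
    refine dual_ext fun m => ?_
    have hTφ : T φ ∈ (dual M).gr (n - 1) := homGr_comp_hom hh hφ (by ring)
    rw [hTs hφ, hTs ((dual M').d_mem hφ), map_sub, map_add, map_smul, map_smul, map_smul,
      dualEval_d M hTφ, hT, hT, hT, dualEval_d M' hφ]
    have h1 : dualEval M m ((DGMod.dualHom f).lin φ) - dualEval M m ((DGMod.dualHom g).lin φ) =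
        dualEval M' (h (M.d m)) φ + dualEval M' (M'.d (h m)) φ := by
      change (show dualSpace M' from φ).1 (f.lin m) - (show dualSpace M' from φ).1 (g.lin m) = _
      rw [← map_sub, Homotopic.apply e, map_add, add_comm]
      rfl
    rw [h1, sg_succ, smul_sub, smul_sub, smul_smul, smul_smul, neg_mul, sg_mul_self, ← sg_add,
      sg_congr (m := n + (n - 1)) (n := 1) (n - 1) (by ring), sg_one]
    simp only [neg_smul, one_smul]
    abel

end DGMod

/-! ### Homotopy retracts of modules with a finite filtered basis -/

namespace DGMod

variable {k : Type v} [Field k] {B : DGAlg.{v, u} k}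

/-- Homotopy retracts of modules with a finite filtered basis. All perfect modules are of this
kind. -/
def IsBasedPerfect (P : DGMod B) : Prop :=
  ∃ F : DGMod B, F.HasFilteredBasis ∧ ∃ (f : Hom F P) (g : Hom P F),
    Homotopic (f.comp g) (Hom.id P)

theorem IsPerfect.isBasedPerfect {P : DGMod B} : P.IsPerfect → P.IsBasedPerfect := by
  rintro ⟨F, hF, h⟩
  exact ⟨F, hF.hasFilteredBasis, h⟩

theorem IsBasedPerfect.isHProj {P : DGMod B} : P.IsBasedPerfect → P.IsHProj := by
  rintro ⟨F, hF, f, g, h⟩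
  exact hF.isHProj.of_retract f g h

theorem IsBasedPerfect.of_retract {P Q : DGMod B} (hQ : Q.IsBasedPerfect) (f : Hom Q P)
    (g : Hom P Q) (h : Homotopic (f.comp g) (Hom.id P)) : P.IsBasedPerfect := by
  obtain ⟨F, hF, f', g', h'⟩ := hQ
  exact ⟨F, hF, f.comp f', g'.comp g, ((h'.comp_left f).comp_right g).trans h⟩

/-- All homotopically projective resolutions of an object of `D_per` are homotopy retracts of
modules with a finite filtered basis. -/
theorem IsBasedPerfect.of_resolution {P P₀ M : DGMod B} (h₀ : P₀.IsBasedPerfect) {π₀ : Hom P₀ M}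
    (hπ₀ : π₀.IsQuasiIso) (hP : P.IsHProj) {π : Hom P M} (hπ : π.IsQuasiIso) :
    P.IsBasedPerfect := by
  obtain ⟨b, hb⟩ := h₀.isHProj.exists_lift hπ π₀
  obtain ⟨g, hg⟩ := hP.exists_lift (hπ.of_comp hπ₀ hb) (Hom.id P)
  exact h₀.of_retract b g hg

theorem IsBasedPerfect.dual {P : DGMod B.op} : P.IsBasedPerfect → (dual P).IsBasedPerfect := by
  rintro ⟨F, hF, f, g, h⟩
  exact ⟨DGMod.dual F, hF.dual, dualHom g, dualHom f, h.dualHom⟩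

/-! ### Naturality of the evaluation morphism -/

theorem tensorComplexMap_comp {L M M' : DGMod B.op} (g : Hom M M') (f : Hom L M) (N : DGMod B) :
    tensorComplexMap (g.comp f) N = tensorComplexMap f N ≫ tensorComplexMap g N := by
  ext1 n
  refine ModuleCat.hom_ext <| LinearMap.ext fun x => Subtype.ext ?_
  change tensorMap (g.comp f) N x.1 = tensorMap g N (tensorMap f N x.1)
  exact tensorGr_induction x.2 (by simp) (fun x y hx hy => by simp only [map_add, hx, hy])
    (fun r x hx => by simp only [map_smul, hx]) fun _ _ _ _ _ _ _ => rfl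

theorem tensorComplexMap_id (M : DGMod B.op) (N : DGMod B) :
    tensorComplexMap (Hom.id M) N = 𝟙 _ := by
  ext1 n
  refine ModuleCat.hom_ext <| LinearMap.ext fun x => Subtype.ext ?_
  change tensorMap (Hom.id M) N x.1 = x.1
  exact tensorGr_induction x.2 (by simp) (fun x y hx hy => by simp only [map_add, hx, hy])
    (fun r x hx => by simp only [map_smul, hx]) fun _ _ _ _ _ _ _ => rfl

theorem homComplexMap_comp {L M M' : DGMod B} (g : Hom M M') (f : Hom L M) (N : DGMod B) :
    homComplexMap (g.comp f) N = homComplexMap g N ≫ homComplexMap f N := by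
  ext1 n
  rfl

theorem homComplexMap_id (M N : DGMod B) : homComplexMap (Hom.id M) N = 𝟙 _ := by
  ext1 n
  rfl

theorem evalComplex_comp {P : DGMod B.op} {Q Q' : DGMod B} (π : Hom Q (dual P)) (g : Hom Q' Q)
    (N : DGMod B) : evalComplex (π.comp g) N = evalComplex π N ≫ homComplexMap g N := by
  ext1 n
  refine ModuleCat.hom_ext <| LinearMap.ext fun x => Subtype.ext ?_
  change eval (π.comp g) N x.1 = eval π N x.1 ∘ₗ g.lin
  refine tensorGr_induction x.2 (by simp)
    (fun x y hx hy => by rw [map_add, map_add, LinearMap.add_comp, hx, hy])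
    (fun r x hx => by rw [map_smul, map_smul, LinearMap.smul_comp, hx])
    fun i j _ a ha b hb => ext_homogeneous Q'.gr fun l q hq => ?_
  rw [LinearMap.comp_apply, eval_tmk _ N ha hb hq, eval_tmk (q := g.lin q) _ N ha hb (g.map_mem hq)]
  rfl

theorem tensorComplexMap_evalComplex {P P' : DGMod B.op} (f : Hom P P') {Q : DGMod B}
    (π : Hom Q (dual P')) (N : DGMod B) :
    tensorComplexMap f N ≫ evalComplex π N = evalComplex ((dualHom f).comp π) N := by
  ext1 n
  refine ModuleCat.hom_ext <| LinearMap.ext fun x => Subtype.ext ?_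
  change eval π N (tensorMap f N x.1) = eval ((dualHom f).comp π) N x.1
  refine tensorGr_induction x.2 (by simp) (fun x y hx hy => by simp only [map_add, hx, hy])
    (fun r x hx => by simp only [map_smul, hx])
    fun i j _ a ha b hb => ext_homogeneous Q.gr fun l q hq => ?_
  rw [tensorMap_tmk, eval_tmk (p := f.lin a) _ N (f.map_mem ha) hb hq, eval_tmk _ N ha hb hq]
  rfl

theorem evalComplex_eq {P : DGMod B.op} {Q : DGMod B} (π : Hom Q (dual P)) (N : DGMod B) :
    evalComplex π N = evalComplex (Hom.id (dual P)) N ≫ homComplexMap π N :=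
  evalComplex_comp (Hom.id (dual P)) π N

variable [HasDerivedCategory.{w} (ModuleCat.{u} k)]

/-- The evaluation morphisms are compatible, in the derived category, with a morphism `f` and a
morphism `g` which corresponds to the dual of `f` up to homotopy. -/
theorem evalComplex_naturality {P P' : DGMod B.op} (f : Hom P P') {Q Q' : DGMod B}
    (π : Hom Q (dual P)) (π' : Hom Q' (dual P')) (g : Hom Q' Q)
    (H : Homotopic (π.comp g) ((dualHom f).comp π')) (N : DGMod B) :
    DerivedCategory.Q.map (evalComplex π N) ≫ DerivedCategory.Q.map (homComplexMap g N) =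
      DerivedCategory.Q.map (tensorComplexMap f N) ≫
        DerivedCategory.Q.map (evalComplex π' N) := by
  rw [← Functor.map_comp, ← Functor.map_comp, ← evalComplex_comp, tensorComplexMap_evalComplex,
    evalComplex_eq (π.comp g), evalComplex_eq ((dualHom f).comp π'), Functor.map_comp,
    Functor.map_comp, H.map_homComplexMap]

/-- A quasi-isomorphism between homotopically projective modules is invertible up to homotopy,
hence induces an isomorphism on `Hom(-, N)`. -/
theorem isIso_map_homComplexMap {L M : DGMod B} (hL : L.IsHProj) (hM : M.IsHProj) {s : Hom L M}
    (hs : s.IsQuasiIso) (N : DGMod B) : IsIso (DerivedCategory.Q.map (homComplexMap s N)) := by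
  obtain ⟨g, hg⟩ := hM.exists_lift hs (Hom.id M)
  obtain ⟨t, ht⟩ := hL.exists_lift (hs.of_comp (Hom.isQuasiIso_id M) hg) (Hom.id L)
  have e1 := hg.map_homComplexMap N
  have e2 := ht.map_homComplexMap N
  rw [homComplexMap_comp, homComplexMap_id, Functor.map_comp, CategoryTheory.Functor.map_id] at e1 e2
  -- `g` induces a morphism with a left and a right inverse
  have h : IsIso (DerivedCategory.Q.map (homComplexMap g N)) := by
    have h1 : IsSplitEpi (DerivedCategory.Q.map (homComplexMap g N)) := ⟨⟨⟨_, e1⟩⟩⟩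
    have h2 : IsSplitMono (DerivedCategory.Q.map (homComplexMap g N)) := ⟨⟨⟨_, e2⟩⟩⟩
    exact isIso_of_mono_of_isSplitEpi _
  rw [(IsIso.eq_comp_inv _).2 e1, Category.id_comp]
  infer_instance

theorem IsBasedPerfect.isIso_map_evalComplex_id {P : DGMod B.op} (hP : P.IsBasedPerfect)
    (N : DGMod B) : IsIso (DerivedCategory.Q.map (evalComplex (Hom.id (DGMod.dual P)) N)) := by
  obtain ⟨F, ⟨b, -, -⟩, f, g, h⟩ := hP
  have hF : IsIso (DerivedCategory.Q.map (evalComplex (Hom.id (DGMod.dual F)) N)) := by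
    have := b.isIso_evalComplex N
    infer_instance
  -- the evaluation morphism of `P` is a retract of that of `F`
  have n1 := evalComplex_naturality f (Hom.id _) (Hom.id _) (dualHom f) (Homotopic.refl _) N
  have n2 := evalComplex_naturality g (Hom.id _) (Hom.id _) (dualHom g) (Homotopic.refl _) N
  have e1 := h.map_tensorComplexMap N
  have e2 : DerivedCategory.Q.map (homComplexMap ((dualHom g).comp (dualHom f)) N) =
    DerivedCategory.Q.map (homComplexMap (Hom.id (DGMod.dual P)) N) :=
      h.dualHom.map_homComplexMap N
  rw [tensorComplexMap_comp, tensorComplexMap_id, Functor.map_comp, CategoryTheory.Functor.map_id] at e1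
  rw [homComplexMap_comp, homComplexMap_id, Functor.map_comp, CategoryTheory.Functor.map_id] at e2
  refine ⟨DerivedCategory.Q.map (homComplexMap (dualHom g) N) ≫
    inv (DerivedCategory.Q.map (evalComplex (Hom.id (DGMod.dual F)) N)) ≫
      DerivedCategory.Q.map (tensorComplexMap f N), ?_, ?_⟩
  · rw [← Category.assoc, n2, Category.assoc, IsIso.hom_inv_id_assoc, e1]
  · rw [Category.assoc, Category.assoc, ← n1, IsIso.inv_hom_id_assoc, e2]

/-- For a perfect right module `P`, and any homotopically projective resolution `Q` of its dual,
the evaluation `P ⊗ N → Hom(Q, N)` is an isomorphism in the derived category. -/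
theorem IsBasedPerfect.isIso_map_evalComplex {P : DGMod B.op} (hP : P.IsBasedPerfect)
    (S : (DGMod.dual P).HProjRes) (N : DGMod B) :
    IsIso (DerivedCategory.Q.map (evalComplex S.π N)) := by
  have h1 := hP.isIso_map_evalComplex_id N
  have h2 := isIso_map_homComplexMap S.hproj hP.dual.isHProj S.quasiIso N
  rw [evalComplex_eq, Functor.map_comp]
  infer_instance

end DGMod

/-! ### Restriction of scalars along an isomorphism -/

namespace DGAlg

variable {k : Type v} [Field k]

/-- Isomorphisms of dg algebras. -/
structure Equiv (C B : DGAlg.{v, u} k) where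
  toAlgEquiv : C ≃ₐ[k] B
  map_mem : ∀ {p : ℤ} {c : C}, c ∈ C.gr p → toAlgEquiv c ∈ B.gr p
  symm_mem : ∀ {p : ℤ} {b : B}, b ∈ B.gr p → toAlgEquiv.symm b ∈ C.gr p
  map_d : ∀ c : C, toAlgEquiv (C.d c) = B.d (toAlgEquiv c)

end DGAlg

namespace DGMod

variable {k : Type v} [Field k] {C B : DGAlg.{v, u} k} (σ : C.Equiv B)

/-- The dg `B`-module `M` as a dg `C`-module, for an isomorphism `σ : C → B`. -/
def restrict (M : DGMod B) : DGMod C where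
  carrier := M.carrier
  module := Module.compHom M.carrier (σ.toAlgEquiv : C →+* B)
  tower := let _ := Module.compHom M.carrier (σ.toAlgEquiv : C →+* B)
    ⟨fun r c m => by
      change σ.toAlgEquiv (r • c) • m = r • (σ.toAlgEquiv c • m)
      rw [map_smul, smul_assoc]⟩
  gr := M.gr
  internal := M.internal
  smul_mem hc hm := M.smul_mem (σ.map_mem hc) hm
  d := M.d
  d_mem := M.d_mem
  d_d := M.d_d
  d_smul {p c} hc m := by
    change M.d (σ.toAlgEquiv c • m) =
      σ.toAlgEquiv (C.d c) • m + sg k p • (σ.toAlgEquiv c • M.d m)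
    rw [M.d_smul (σ.map_mem hc), σ.map_d]

variable {M N : DGMod B}

/-- The morphism `f`, viewed as a morphism of dg `C`-modules. -/
def Hom.restrict (f : Hom M N) : Hom (M.restrict σ) (N.restrict σ) where
  toLin :=
    { toFun := f.lin
      map_add' := map_add f.lin
      map_smul' := fun c m => f.lin_smul (σ.toAlgEquiv c) m }
  map_mem := f.map_mem
  map_d := f.map_d

theorem Homotopic.restrict {f g : Hom M N} : Homotopic f g →
    Homotopic (f.restrict σ) (g.restrict σ) := by
  rintro ⟨h, hh, e⟩
  exact ⟨h, ⟨hh.1, fun p c hc m => hh.2 p (σ.toAlgEquiv c) (σ.map_mem hc) m⟩, e⟩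

/-- A homogeneous basis over `B`, viewed as a basis over `C`. -/
def HomogBasis.restrict (b : M.HomogBasis) : (M.restrict σ).HomogBasis where
  ι := b.ι
  deg := b.deg
  e := b.e
  coord i := σ.toAlgEquiv.symm.toLinearMap ∘ₗ b.coord i
  e_mem := b.e_mem
  coord_mem i {p x} hx := σ.symm_mem (b.coord_mem i hx)
  coord_smul i c x := by
    change σ.toAlgEquiv.symm (b.coord i (σ.toAlgEquiv c • (show M from x))) =
      c * σ.toAlgEquiv.symm (b.coord i x)
    rw [b.coord_smul, map_mul, AlgEquiv.symm_apply_apply]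
  coord_e i j := by
    change σ.toAlgEquiv.symm (b.coord i (b.e j)) = _
    rw [b.coord_e]
    split_ifs
    · exact map_one _
    · exact map_zero _
  sum_coord x := by
    change ∑ i, (σ.toAlgEquiv (σ.toAlgEquiv.symm (b.coord i x)) • b.e i : M) = x
    simp only [AlgEquiv.apply_symm_apply]
    exact b.sum_coord x

theorem IsBasedPerfect.restrict {P : DGMod B} : P.IsBasedPerfect →
    (P.restrict σ).IsBasedPerfect := by
  rintro ⟨F, ⟨b, r, hb⟩, f, g, h⟩
  refine ⟨F.restrict σ, ⟨b.restrict σ, r, fun i j hij => ?_⟩, f.restrict σ, g.restrict σ,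
    h.restrict σ⟩
  change σ.toAlgEquiv.symm (b.coord j (F.d (b.e i))) = 0
  rw [hb i j hij, map_zero]

end DGMod

/-! ### The symmetry of the enveloping algebra -/

namespace DGAlg

variable {k : Type v} [Field k] (A : DGAlg.{v, u} k)

/-- The bilinear map `(a, b) ↦ b ⊗ a`. -/
def envMkFlip : A →ₗ[k] A →ₗ[k] A.env :=
  ((TensorProduct.mk k A A.op).compr₂
    (GradedTensorProduct.of k A.gr A.op.gr).toLinearMap).flip ∘ₗ A.toOp.toLinearMap

/-- The map `a ⊗ b ↦ (-1)^{|a||b|} b ⊗ a` on `Aᵉ`. -/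
def swapMap : A.env →ₗ[k] A.env :=
  TensorProduct.lift ((koszul A.gr A.gr A.envMkFlip).compl₂ A.toOp.symm.toLinearMap) ∘ₗ
    (GradedTensorProduct.of k A.gr A.op.gr).symm.toLinearMap

theorem swapMap_envMk {p q : ℤ} {a b : A} (ha : a ∈ A.gr p) (hb : b ∈ A.gr q) :
    A.swapMap (A.envMk a b) = sg k (p * q) • A.envMk b a :=
  koszul_apply A.gr A.gr A.envMkFlip ha hb

theorem envMk_mem {p q : ℤ} {a b : A} (ha : a ∈ A.gr p) (hb : b ∈ A.gr q) :
    A.envMk a b ∈ A.env.gr (p + q) :=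
  tmul_mem (B := A.op) rfl ha hb

theorem swapMap_mem {n : ℤ} {x : A.env} (hx : x ∈ A.env.gr n) : A.swapMap x ∈ A.env.gr n := by
  refine DGMod.env_mem_induction A hx (by rw [map_zero]; exact zero_mem _)
    (fun x y hx hy => by rw [map_add]; exact add_mem hx hy)
    (fun r x hx => by rw [map_smul]; exact Submodule.smul_mem _ r hx)
    fun p q h a ha b hb => ?_
  rw [A.swapMap_envMk ha hb]
  exact Submodule.smul_mem _ _ (A.env.mem_deg (A.envMk_mem hb ha) (by omega))

theorem swapMap_swapMap (x : A.env) : A.swapMap (A.swapMap x) = x := by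
  refine DGMod.env_induction A x (by simp) (fun x y hx hy => by simp only [map_add, hx, hy])
    fun p q a ha b hb => ?_
  rw [A.swapMap_envMk ha hb, map_smul, A.swapMap_envMk hb ha, smul_smul, mul_comm q p,
    sg_mul_self, one_smul]

theorem swapMap_d (x : A.env) : A.swapMap (A.env.d x) = A.env.d (A.swapMap x) := by
  refine DGMod.env_induction A x (by simp) (fun x y hx hy => by simp only [map_add, hx, hy])
    fun p q a ha b hb => ?_
  rw [DGMod.env_d A ha, map_add, map_smul, A.swapMap_envMk ha hb, A.swapMap_envMk (A.d_mem ha) hb,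
    A.swapMap_envMk ha (A.d_mem hb), map_smul, DGMod.env_d A hb, smul_add, smul_smul, smul_smul,
    ← sg_add, ← sg_add, add_comm, sg_congr (m := p + p * (q + 1)) (n := p * q) p (by ring),
    sg_congr (m := p * q + q) (n := (p + 1) * q) 0 (by ring)]

/-- The map `a ⊗ b ↦ (-1)^{|a||b|} b ⊗ a` reverses the multiplication. -/
theorem swapMap_opMul (x y : A.env) :
    A.swapMap (A.env.opMul x y) = A.swapMap x * A.swapMap y := by
  refine DGMod.env_induction A x (by simp)
    (fun x y hx hy => by simp only [map_add, LinearMap.add_apply, add_mul, hx, hy])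
    fun p q a ha b hb => ?_
  refine DGMod.env_induction A y (by simp)
    (fun x y hx hy => by simp only [map_add, mul_add, hx, hy]) fun p' q' a' ha' b' hb' => ?_
  rw [A.env.opMul_apply (A.envMk_mem ha hb) (A.envMk_mem ha' hb'), DGMod.env_mul A a' hb' ha hb,
    map_smul, map_smul, A.swapMap_envMk (A.mul_mem ha' ha) (A.mul_mem hb hb'),
    A.swapMap_envMk ha hb, A.swapMap_envMk ha' hb', smul_mul_smul_comm,
    DGMod.env_mul A b ha hb' ha', smul_smul, smul_smul, smul_smul, ← sg_add, ← sg_add, ← sg_add,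
    ← sg_add]
  congr 1
  exact sg_congr (p * q' + q * q' + p' * q) (by ring)

theorem swapMap_one : A.swapMap 1 = 1 := by
  refine (A.swapMap_envMk A.one_mem A.one_mem).trans ?_
  rw [mul_zero, sg_zero, one_smul]
  rfl

/-- The isomorphism `a ⊗ b ↦ (-1)^{|a||b|} b ⊗ a` between the opposite of `Aᵉ` and `Aᵉ`. -/
def swap : A.env.op.Equiv A.env where
  toAlgEquiv := AlgEquiv.ofLinearEquiv
    (A.env.toOp.symm.trans (LinearEquiv.ofInvolutive A.swapMap A.swapMap_swapMap))
    A.swapMap_one A.swapMap_opMul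
  map_mem hc := A.swapMap_mem hc
  symm_mem hb := A.swapMap_mem hb
  map_d c := A.swapMap_d c

end DGAlg

namespace DGMod

variable {k : Type v} [Field k] (A : DGAlg.{v, u} k)

/-- Under `swap`, the left module `A` over `Aᵉ` becomes the right module `Aᵒᵖ`. -/
theorem diagOp_smul (c : A.env.op) (x : A) :
    (c • (show diagOp A from x) : diagOp A) = envAct A (A.swapMap (A.env.toOp.symm c)) x := by
  change opAct A A.gr A.internal (rightAct A) (A.env.toOp.symm c) x = _
  generalize A.env.toOp.symm c = y
  refine hom_induction A.gr x (by simp) (fun x y hx hy => by simp only [map_add, hx, hy])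
    fun r x hx => ?_
  refine env_induction A y (by simp)
    (fun x y hx hy => by simp only [map_add, LinearMap.add_apply, hx, hy]) fun p q a ha b hb => ?_
  rw [opAct_apply _ _ (A.envMk_mem ha hb) hx, rightAct_envMk A ha hb hx, A.swapMap_envMk ha hb,
    map_smul, LinearMap.smul_apply, envAct_envMk, A.opMul_apply ha hx, mul_smul_comm, smul_smul,
    smul_smul, ← sg_add, ← sg_add]
  congr 1
  exact sg_congr (q * r) (by ring)

/-- A morphism `P → A` of left modules as a morphism to the right module `Aᵒᵖ`. -/
def Hom.toDiagOp {A : DGAlg.{v, u} k} {P : DGMod A.env} (f : Hom P (diag A)) :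
    Hom (P.restrict A.swap) (diagOp A) where
  toLin :=
    { toFun := f.lin
      map_add' := map_add f.lin
      map_smul' := fun c m => by
        refine (f.lin_smul (A.swap.toAlgEquiv c) m).trans ?_
        exact (diagOp_smul A c (f.lin m)).symm }
  map_mem := f.map_mem
  map_d := f.map_d

/-- If `A` is homologically smooth, a perfect resolution of the left module `A` becomes one of the
right module `Aᵒᵖ` under `swap`. -/
theorem exists_isBasedPerfect_resolution {A : DGAlg.{v, u} k} (h : A.IsHomologicallySmooth) :
    ∃ (P : DGMod A.env.op) (π : Hom P (diagOp A)), P.IsBasedPerfect ∧ π.IsQuasiIso := by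
  obtain ⟨P, f, hP, hf⟩ := h
  exact ⟨P.restrict A.swap, f.toDiagOp, hP.isBasedPerfect.restrict A.swap, hf⟩

end DGMod

end DG

end

/-- For a proper and homologically smooth dg algebra `A`, the evaluation morphism
`Aᵒᵖ ⊗ᴸ_{Aᵉ} A → RHom_{Aᵉ}(ω_A⁻¹, A)`, where `ω_A⁻¹ = RHom_{Aᵉ}(Aᵒᵖ, Aᵉ)`, is defined, is an
isomorphism in `D(k)`, and is compatible with the changes of resolutions. -/
theorem mainTheorem7 {k : Type v} [Field k] [CharZero k]
    [HasDerivedCategory.{w} (ModuleCat.{u} k)] (A : DG.DGAlg.{v, u} k) (hproper : A.IsProper)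
    (hsmooth : A.IsHomologicallySmooth) :
    -- the resolutions which define the derived functors exist
    (Nonempty (DG.DGMod.diagOp A).HProjRes ∧
      ∀ R : (DG.DGMod.diagOp A).HProjRes, Nonempty (DG.DGAlg.invOmega R).HProjRes) ∧
    -- for all resolutions, the evaluation morphism is an isomorphism in the derived category
    (∀ (R : (DG.DGMod.diagOp A).HProjRes) (S : (DG.DGAlg.invOmega R).HProjRes),
      IsIso (DerivedCategory.Q.map (DG.DGAlg.hochschildEval S))) ∧
    -- any two resolutions of `Aᵒᵖ` can be compared
    (∀ R R' : (DG.DGMod.diagOp A).HProjRes, ∃ f : DG.DGMod.Hom R.P R'.P,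
      DG.DGMod.Homotopic (R'.π.comp f) R.π) ∧
    -- for every comparison map, the resolutions of `ω_A⁻¹` can be compared, and the evaluation
    -- morphisms correspond to each other in the derived category
    (∀ (R R' : (DG.DGMod.diagOp A).HProjRes) (f : DG.DGMod.Hom R.P R'.P),
      DG.DGMod.Homotopic (R'.π.comp f) R.π →
      ∀ (S : (DG.DGAlg.invOmega R).HProjRes) (S' : (DG.DGAlg.invOmega R').HProjRes),
        (∃ g : DG.DGMod.Hom S'.P S.P,
          DG.DGMod.Homotopic (S.π.comp g) ((DG.DGMod.dualHom f).comp S'.π)) ∧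
        ∀ g : DG.DGMod.Hom S'.P S.P,
          DG.DGMod.Homotopic (S.π.comp g) ((DG.DGMod.dualHom f).comp S'.π) →
          DerivedCategory.Q.map (DG.DGAlg.hochschildEval S) ≫
              DerivedCategory.Q.map (DG.DGMod.homComplexMap g (DG.DGMod.diag A)) =
            DerivedCategory.Q.map (DG.DGMod.tensorComplexMap f (DG.DGMod.diag A)) ≫
              DerivedCategory.Q.map (DG.DGAlg.hochschildEval S')) := by
  obtain ⟨P, π, hP, hπ⟩ := DG.DGMod.exists_isBasedPerfect_resolution hsmooth
  have hR (R : (DG.DGMod.diagOp A).HProjRes) : R.P.IsBasedPerfect :=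
    hP.of_resolution hπ R.hproj R.quasiIso
  refine ⟨⟨⟨⟨P, π, hP.isHProj, hπ⟩⟩, fun R => ?_⟩, fun R S => ?_, fun R R' => ?_,
    fun R R' f _ S S' => ⟨?_, fun g hg => ?_⟩⟩
  · exact ⟨⟨_, DG.DGMod.Hom.id _, (hR R).dual.isHProj, DG.DGMod.Hom.isQuasiIso_id _⟩⟩
  · exact (hR R).isIso_map_evalComplex S _
  · exact R.hproj.exists_lift R'.quasiIso R.π
  · exact S'.hproj.exists_lift S.quasiIso ((DG.DGMod.dualHom f).comp S'.π)
  · exact DG.DGMod.evalComplex_naturality f S.π S'.π g hg _
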